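/- Let $n\ge 1$ and let $\mathcal D$ be the collection of all open dyadic cubes $\prod_{i=1}^n\big(m_i2^{-k},(m_i+1)2^{-k}\big)$ in $\mathbb R^n$, $k\in\mathbb Z$, $m\in\mathbb Z^n$. Write $\langle f\rangle_J=\frac1{|J|}\int_J f$ for averages with respect to Lebesgue measure, and for locally integrable $\varphi\colon\mathbb R^n\to\mathbb R$ put $$\|\varphi\|_{{\rm BMO}^d}=\sup_{J\in\mathcal D}\big\langle|\varphi-\langle\varphi\rangle_J|^2\big\rangle_J^{1/2}\in[0,\infty].$$ For $\varepsilon\ge0$ let ${\rm BMO}^d_\varepsilon(\mathbb R^n)$ be the set of all $\varphi\in L^1_{loc}(\mathbb R^n)$ with $\|\varphi\|_{{\rm BMO}^d}\le\varepsilon$. For $\varepsilon\ge 0$ and $C>0$ consider the integral John–Nirenberg inequality $$\langle e^{\varphi}\rangle_Q\le C\,e^{\langle\varphi\rangle_Q}\qquad\text{for all }\varphi\in{\rm BMO}^d_\varepsilon(\mathbb R^n)\text{ and all }Q\in\mathcal D.\tag{$*$}$$ Let $\varepsilon_0^d(n)$ be the largest number $\varepsilon_0>0$ such that for every $0\le\varepsilon<\varepsilon_0$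 there is a finite constant $C>0$ for which $(*)$ holds, and, for $0\le\varepsilon<\varepsilon_0^d(n)$, let $C(\varepsilon,n)$ be the smallest $C>0$ for which $(*)$ holds. Then these extremal values exist, and $$\varepsilon_0^d(n)=\frac{2^{n/2}}{2^n-1}\,n\log 2,\qquad C(\varepsilon,n)=\frac{2^n-1}{2^n e^{2^{-n/2}\varepsilon}-e^{2^{n/2}\varepsilon}}\quad\text{for all }0\le\varepsilon<\varepsilon_0^d(n).$$ -/

import Mathlib

open MeasureTheory
open scoped ENNReal

namespace DyadicBMO

/-- The open dyadic cube of side length `2 ^ (-k)` and lower-left corner `2 ^ (-k) • m` in `ℝⁿ`,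
that is, the product of the intervals `(m i * 2 ^ (-k), (m i + 1) * 2 ^ (-k))`. -/
def dyadicCube {n : ℕ} (k : ℤ) (m : Fin n → ℤ) : Set (Fin n → ℝ) :=
  Set.univ.pi fun i => Set.Ioo ((m i : ℝ) * (2 : ℝ) ^ (-k)) (((m i : ℝ) + 1) * (2 : ℝ) ^ (-k))

/-- The dyadic lattice on `ℝⁿ`: all dyadic cubes, of all scales `k ∈ ℤ`. -/
def dyadicLattice (n : ℕ) : Set (Set (Fin n → ℝ)) :=
  {J | ∃ (k : ℤ) (m : Fin n → ℤ), J = dyadicCube k m}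

/-- The `p`-oscillation of `φ` over `J`: the average over `J` of `|φ - ⟨φ⟩_J| ^ p`, with values
in `[0, ∞]`. -/
noncomputable def oscillation {n : ℕ} (p : ℝ) (J : Set (Fin n → ℝ)) (φ : (Fin n → ℝ) → ℝ) :
    ℝ≥0∞ :=
  ⨍⁻ x in J, ENNReal.ofReal (|φ x - ⨍ y in J, φ y ∂volume| ^ p) ∂volume

/-- The `L²`-based dyadic BMO norm on `ℝⁿ`, with values in `[0, ∞]`. -/
noncomputable def bmoNorm {n : ℕ} (φ : (Fin n → ℝ) → ℝ) : ℝ≥0∞ :=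
  ⨆ J ∈ dyadicLattice n, (oscillation 2 J φ) ^ ((1 : ℝ) / 2)

/-- The ball `BMO_ε^d(ℝⁿ)`: locally integrable functions whose dyadic BMO norm is at most `ε`. -/
def bmoBall (n : ℕ) (ε : ℝ) : Set ((Fin n → ℝ) → ℝ) :=
  {φ | LocallyIntegrable φ volume ∧ bmoNorm φ ≤ ENNReal.ofReal ε}

/-- The integral John–Nirenberg inequality with constant `C` on `BMO_ε^d(ℝⁿ)`. The average of
`exp φ` is taken in `[0, ∞]`, so that the inequality includes its finiteness. -/
def JohnNirenberg (n : ℕ) (ε C : ℝ) : Prop :=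
  ∀ φ ∈ bmoBall n ε, ∀ Q ∈ dyadicLattice n,
    ⨍⁻ x in Q, ENNReal.ofReal (Real.exp (φ x)) ∂volume ≤
      ENNReal.ofReal (C * Real.exp (⨍ x in Q, φ x ∂volume))

/-- The admissible thresholds `ε₀ > 0`: for every `0 ≤ ε < ε₀` the integral John–Nirenberg
inequality holds on `BMO_ε^d(ℝⁿ)` with some finite constant, depending only on `ε` and `n`. -/
def admissibleThresholds (n : ℕ) : Set ℝ :=
  {ε₀ | 0 < ε₀ ∧ ∀ ε, 0 ≤ ε → ε < ε₀ → ∃ C, 0 < C ∧ JohnNirenberg n ε C}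

/-- The admissible constants `C > 0` in the integral John–Nirenberg inequality for a given `ε`. -/
def admissibleConstants (n : ℕ) (ε : ℝ) : Set ℝ :=
  {C | 0 < C ∧ JohnNirenberg n ε C}

end DyadicBMO

/-!
Write `N = 2 ^ n` and `q = 2 ^ (n / 2)`, so that `q ^ 2 = N`.

**Upper bound.** The data of `φ` on a dyadic cube are its mean `m` and its variance `v ∈ [0, ε²]`.
The Bellman function is `envelope δ m v = exp m * E (√(δ² - v))` with `E t = (1 - t) * exp t`; up
to a constant factor it is the minimal locally concave function with boundary values `exp m` on
`v = 0` in the enlarged domain `0 ≤ v ≤ δ²`. With `σ = √(δ² - ε²)`, the number `δ < 1` is chosen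
so that `E σ / E δ` is the claimed constant, which says that the main inequality
  average of `envelope` over the `N` children `≤ envelope` of the parent
is an equality for the configuration in which `N - 1` children are constant and one child again has
variance `ε²`. The function is not concave along every segment that joins admissible points, so the
main inequality is proved by hand. `IsBellmanPair.envelope_sum_le` splits off the children one at a
time, always one whose removal does not increase the variance; this leaves two-point splittings with
weights in `[1 / N, 1 - 1 / N]`. In the two-point inequality the defect at the parent is a weighted
sum of two values of `tangentGap` (`binary_defect_eq`), at most one of them negative. A comparison
in the weight and the position of the lower point (`tangentGap_comparison`) reduces
the bad case to weight `1 / N` and a constant lower part, where one-variable monotonicity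
(`IsBellmanPair.tip`) finishes.
Iterating over the generations bounds the averages of `exp` of the conditional means, and Fatou's
lemma with Lebesgue differentiation along dyadic cubes gives the inequality for `φ`
(`IsBellmanPair.johnNirenberg`).

**Sharpness.** The function `extremal` takes the value `j (N - 1) γ - γ`, `γ = ε / q`, on the shell
`[0, 2 ^ (-j))ⁿ \ [0, 2 ^ (-j - 1))ⁿ` and vanishes off the unit cube. Its relevant integrals
telescope (`setLIntegral_depth`); it has norm at most `ε`, and its exponential average is the claimed
constant. As `ε` tends to the threshold these constants blow up, so no larger threshold is
admissible.
-/

namespace DyadicBMO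

/-! ### The profile `(1 - t) * exp t` and its tangent gap -/

/-- The profile `E t = (1 - t) * exp t` of the Bellman function. -/
noncomputable def profile (t : ℝ) : ℝ := (1 - t) * Real.exp t

lemma exp_neg_le_quadratic {t : ℝ} (ht : 0 ≤ t) : Real.exp (-t) ≤ 1 - t + t ^ 2 / 2 := by
  have h := Real.quadratic_le_exp_of_nonneg ht
  have h2 : (0 : ℝ) < 1 - t + t ^ 2 / 2 := by nlinarith [sq_nonneg (t - 1)]
  rw [Real.exp_neg]
  refine inv_le_of_inv_le₀ h2 (le_trans ?_ h)
  rw [inv_eq_one_div, div_le_iff₀ h2]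
  nlinarith [sq_nonneg (t ^ 2)]

lemma half_sub_mul_exp_remainder_le {u : ℝ} (hu : 0 ≤ u) :
    (1 - u / 2) * (Real.exp u - 1 - u) ≤ u ^ 2 / 2 := by
  let η : ℝ → ℝ := fun u => 1 - Real.exp u + u * (Real.exp u + 1) / 2
  have hd : ∀ x, HasDerivAt η ((1 - Real.exp x * (1 - x)) / 2) x := by
    intro x
    have h1 := Real.hasDerivAt_exp x
    have := (h1.const_sub 1).add (((hasDerivAt_id x).mul (h1.add_const 1)).div_const 2)
    refine this.congr_deriv ?_
    simp; ring
  have hm : Monotone η := by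
    refine monotone_of_deriv_nonneg (fun x => (hd x).differentiableAt) fun x => ?_
    rw [(hd x).deriv]
    have h1 : 1 - x ≤ Real.exp (-x) := by linarith [Real.add_one_le_exp (-x)]
    have h2 : Real.exp x * (1 - x) ≤ Real.exp x * Real.exp (-x) := by gcongr
    rw [← Real.exp_add] at h2
    simp at h2
    linarith
  have := hm hu
  simp only [η, Real.exp_zero] at this
  linarith

/-- The amount, divided by `exp s`, by which the tangent plane of `(m, v) ↦ exp m * E (√(δ² - v))`
at the point with `m = 0`, `√(δ² - v) = s` exceeds the function at the point with `m = s - a`,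
`√(δ² - v) = r`, in the coordinates `(m, v + m²)` given by the first two moments. It does not depend
on `s`. -/
noncomputable def tangentGap (a r : ℝ) : ℝ :=
  (1 - a) - (1 - r) * Real.exp (r - a) - (r ^ 2 - a ^ 2) / 2

/-- With `u = r - a` the gap is `u² / 2 - (1 - r) * (exp u - 1 - u)`; the hypothesis is
`u ≤ 2 * r`. -/
lemma tangentGap_nonneg {a r : ℝ} (hr : 0 ≤ r) (har : -r ≤ a) : 0 ≤ tangentGap a r := by
  obtain ⟨u, rfl⟩ : ∃ u, a = r - u := ⟨r - a, by ring⟩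
  have key : (1 - r) * (Real.exp u - 1 - u) ≤ u ^ 2 / 2 := by
    have h0 : 0 ≤ Real.exp u - 1 - u := by linarith [Real.add_one_le_exp u]
    rcases le_total u 0 with hu | hu
    · have := exp_neg_le_quadratic (t := -u) (by linarith)
      rw [neg_neg] at this
      nlinarith
    · have := half_sub_mul_exp_remainder_le hu
      nlinarith
  unfold tangentGap
  rw [show r - (r - u) = u by ring]
  nlinarith

lemma profile_le_tangent {a r : ℝ} (hr : 0 ≤ r) (har : -r ≤ a) :
    profile r ≤ profile a - Real.exp a * (r ^ 2 - a ^ 2) / 2 := by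
  have h := mul_nonneg (Real.exp_pos a).le (tangentGap_nonneg hr har)
  have he : Real.exp r = Real.exp a * Real.exp (r - a) := by rw [← Real.exp_add]; ring_nf
  unfold tangentGap at h
  unfold profile
  rw [he]
  nlinarith

lemma hasDerivAt_profile (x : ℝ) : HasDerivAt profile (-x * Real.exp x) x := by
  refine (((hasDerivAt_id x).const_sub 1).mul (Real.hasDerivAt_exp x)).congr_deriv ?_
  simp; ring

lemma continuous_profile : Continuous profile :=
  continuous_iff_continuousAt.2 fun x => (hasDerivAt_profile x).continuousAt

lemma profile_antitoneOn : AntitoneOn profile (Set.Ici 0) := by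
  refine antitoneOn_of_deriv_nonpos (convex_Ici 0) continuous_profile.continuousOn
    (fun x _ => (hasDerivAt_profile x).differentiableAt.differentiableWithinAt) fun x hx => ?_
  rw [interior_Ici] at hx
  rw [(hasDerivAt_profile x).deriv]
  have : 0 < x := hx
  nlinarith [Real.exp_pos x]

lemma profile_monotoneOn : MonotoneOn profile (Set.Iic 0) := by
  refine monotoneOn_of_deriv_nonneg (convex_Iic 0) continuous_profile.continuousOn
    (fun x _ => (hasDerivAt_profile x).differentiableAt.differentiableWithinAt) fun x hx => ?_
  rw [interior_Iic] at hx
  rw [(hasDerivAt_profile x).deriv]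
  have : x < 0 := hx
  nlinarith [Real.exp_pos x]

lemma profile_pos {t : ℝ} (ht : t < 1) : 0 < profile t :=
  mul_pos (by linarith) (Real.exp_pos t)

lemma hasDerivAt_tangentGap_sqrt {a l τ : ℝ} (hl : 0 < l) (hτ : 0 < τ) :
    HasDerivAt (fun τ => l * tangentGap a (√(a ^ 2 + τ / l)))
      ((Real.exp (√(a ^ 2 + τ / l) - a) - 1) / 2) τ := by
  have hpos : 0 < a ^ 2 + τ / l := by positivity
  have h1 : HasDerivAt (fun τ => a ^ 2 + τ / l) (1 / l) τ :=
    ((hasDerivAt_id τ).div_const l).const_add _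
  have h2 := h1.sqrt hpos.ne'
  set ρ := √(a ^ 2 + τ / l) with hρ
  have hρpos : 0 < ρ := Real.sqrt_pos.2 hpos
  have h3 : HasDerivAt (tangentGap a) (ρ * (Real.exp (ρ - a) - 1)) ρ := by
    have e := ((hasDerivAt_id ρ).sub_const a).exp
    have := ((((hasDerivAt_id ρ).const_sub 1).mul e).const_sub (1 - a)).sub
      (((hasDerivAt_pow 2 ρ).sub_const (a ^ 2)).div_const 2)
    refine this.congr_deriv ?_
    simp; ring
  refine ((h3.comp τ h2).const_mul l).congr_deriv ?_
  field_simp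

/-- The gap of a point of relative weight `l` lying `√(a² + M / l)` high: differentiating in `M`
compares the two sides through `√(a² + τ / l) - a`, which decreases in `l` and in `l * a`. -/
lemma tangentGap_comparison {a₁ a₂ l₁ l₂ M : ℝ} (ha₁ : 0 ≤ a₁) (ha₂ : 0 ≤ a₂) (hl₁ : 0 < l₁)
    (hl : l₁ ≤ l₂) (hla : l₁ * a₁ ≤ l₂ * a₂) (hM : 0 ≤ M) :
    l₂ * tangentGap a₂ (√(a₂ ^ 2 + M / l₂)) ≤ l₁ * tangentGap a₁ (√(a₁ ^ 2 + M / l₁)) := by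
  have hl₂ : 0 < l₂ := hl₁.trans_le hl
  let g : ℝ → ℝ := fun τ => l₁ * tangentGap a₁ (√(a₁ ^ 2 + τ / l₁)) -
    l₂ * tangentGap a₂ (√(a₂ ^ 2 + τ / l₂))
  have hd : ∀ τ, 0 < τ → HasDerivAt g _ τ := fun τ hτ =>
    (hasDerivAt_tangentGap_sqrt (a := a₁) hl₁ hτ).sub (hasDerivAt_tangentGap_sqrt (a := a₂) hl₂ hτ)
  have hm : MonotoneOn g (Set.Ici 0) := by
    refine monotoneOn_of_deriv_nonneg (convex_Ici 0) ?_ ?_ fun τ hτ => ?_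
    · have : Continuous g := by
        simp only [g, tangentGap]
        fun_prop
      exact this.continuousOn
    · rw [interior_Ici]
      exact fun τ hτ => (hd τ hτ).differentiableAt.differentiableWithinAt
    · rw [interior_Ici] at hτ
      have hτ' : 0 < τ := hτ
      rw [(hd τ hτ).deriv]
      suffices √(a₂ ^ 2 + τ / l₂) - a₂ ≤ √(a₁ ^ 2 + τ / l₁) - a₁ by
        have := Real.exp_le_exp.2 this
        linarith
      have key : √(a₂ ^ 2 + τ / l₂) ≤ a₂ + (√(a₁ ^ 2 + τ / l₁) - a₁) := by
        set ρ := √(a₁ ^ 2 + τ / l₁) with hρ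
        have hsq : ρ ^ 2 = a₁ ^ 2 + τ / l₁ := Real.sq_sqrt (by positivity)
        have hge : a₁ ≤ ρ := Real.le_sqrt_of_sq_le (by
          have : 0 ≤ τ / l₁ := by positivity
          linarith)
        obtain ⟨θ, hθ⟩ : ∃ θ, ρ = a₁ + θ := ⟨ρ - a₁, by ring⟩
        have hθ0 : 0 ≤ θ := by linarith
        have hτ2 : τ = l₁ * (2 * a₁ * θ + θ ^ 2) := by
          rw [hθ] at hsq
          field_simp at hsq
          nlinarith
        rw [hθ]
        refine Real.sqrt_le_iff.2 ⟨by linarith, ?_⟩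
        have : τ / l₂ ≤ 2 * a₂ * θ + θ ^ 2 := by
          rw [div_le_iff₀ hl₂, hτ2]
          nlinarith [mul_le_mul_of_nonneg_right hla hθ0,
            mul_le_mul_of_nonneg_right hl (sq_nonneg θ)]
        nlinarith
      linarith
  have := hm (Set.mem_Ici.2 le_rfl) (Set.mem_Ici.2 hM) hM
  have hg0 : g 0 = 0 := by
    simp [g, Real.sqrt_sq ha₁, Real.sqrt_sq ha₂, tangentGap]
  rw [hg0] at this
  simp only [g] at this
  linarith

/-! ### The two-point inequality with a constant lower part -/

/-- The defect in the two-point inequality with weights `β`, `1 - β` at distance `D`, base point at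
height `s`; `hrel` says that the variance of the mixture is that of the base point. -/
lemma binary_defect_eq {β D s ry rz : ℝ}
    (hrel : β * ry ^ 2 + (1 - β) * rz ^ 2 = s ^ 2 + β * (1 - β) * D ^ 2) :
    profile s - (β * (Real.exp ((1 - β) * D) * profile ry) +
        (1 - β) * (Real.exp (-(β * D)) * profile rz)) =
      Real.exp s * (β * tangentGap (s - (1 - β) * D) ry + (1 - β) * tangentGap (s + β * D) rz) := by
  have h1 : Real.exp ((1 - β) * D) * Real.exp ry =
      Real.exp s * Real.exp (ry - (s - (1 - β) * D)) := by
    rw [← Real.exp_add, ← Real.exp_add]; ring_nf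
  have h2 : Real.exp (-(β * D)) * Real.exp rz =
      Real.exp s * Real.exp (rz - (s + β * D)) := by
    rw [← Real.exp_add, ← Real.exp_add]; ring_nf
  unfold profile tangentGap
  linear_combination (-β * (1 - ry)) * h1 - (1 - β) * (1 - rz) * h2 + Real.exp s / 2 * hrel

/-- The parameters of the Bellman function for the BMO bound `ε` when every cube has `q ^ 2`
children: `σ` and `δ` are the values of `√(δ² - v)` at `v = ε²` and at `v = 0`. By `profile_eq` the
ratio `profile σ / profile δ` is the sharp constant. -/
structure IsBellmanPair (q ε σ δ : ℝ) : Prop where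
  one_lt : 1 < q
  eps_nonneg : 0 ≤ ε
  sigma_nonneg : 0 ≤ σ
  delta_nonneg : 0 ≤ δ
  delta_lt_one : δ < 1
  sq_eq : δ ^ 2 = σ ^ 2 + ε ^ 2
  profile_eq : profile σ * (q ^ 2 * Real.exp (ε / q) - Real.exp (q * ε)) = (q ^ 2 - 1) * profile δ

/-- In the two-point inequality with a constant lower part, raising the variance of the tip at a
fixed distance `D` only makes the inequality stronger. -/
lemma exp_profile_sub_mono {b D r r' s s' : ℝ} (hb : 0 ≤ b) (hr' : 0 ≤ r') (hs' : 0 ≤ s')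
    (hr : r' ≤ r) (hs : s' ≤ s) (hrel : s ^ 2 - s' ^ 2 = b * (r ^ 2 - r' ^ 2))
    (hD : s + b * D ≤ D + r') :
    Real.exp (b * D) * profile s' - b * (Real.exp D * profile r') ≤
      Real.exp (b * D) * profile s - b * (Real.exp D * profile r) := by
  have h1 := profile_le_tangent (a := s) (r := s') hs' (by linarith)
  have h2 := profile_le_tangent (a := r') (r := r) (by linarith) (by linarith)
  have h3 : Real.exp (b * D) * Real.exp s ≤ Real.exp D * Real.exp r' := by
    rw [← Real.exp_add, ← Real.exp_add]
    exact Real.exp_le_exp.2 (by linarith)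
  have h4 : 0 ≤ b * (r ^ 2 - r' ^ 2) := mul_nonneg hb (by nlinarith)
  have h5 := mul_le_mul_of_nonneg_left h1 (Real.exp_pos (b * D)).le
  have h6 := mul_le_mul_of_nonneg_left h2 (mul_nonneg hb (Real.exp_pos D).le)
  have h7 := mul_le_mul_of_nonneg_right h3 h4
  have h8 : s' ^ 2 - s ^ 2 = -(b * (r ^ 2 - r' ^ 2)) := by linarith
  rw [h8] at h5
  nlinarith

/-- Equality in the two-point inequality for the extremal configuration: weight `b = 1 / q ^ 2` at
distance `q * ε`, the base point and the tip having variance `ε²`. -/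
lemma IsBellmanPair.endpoint {q ε σ δ b : ℝ} (h : IsBellmanPair q ε σ δ) (hb : b * q ^ 2 = 1) :
    Real.exp (b * (q * ε)) * profile σ - b * (Real.exp (q * ε) * profile σ) =
      (1 - b) * profile δ := by
  have hq : 0 < q := one_pos.trans h.one_lt
  have : b * (q * ε) = ε / q := by
    field_simp
    linear_combination ε * hb
  rw [this]
  linear_combination b * h.profile_eq +
    (- Real.exp (ε / q) * profile σ + profile δ) * hb

/-- The case of a tip of variance `ε²` at distance at most the extremal one. As a function of `D` the
difference of the two sides first increases from a nonnegative value and then decreases to `0` at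
`D = q * ε`, because the sign of its derivative is that of `E (-ξ) - E σ`, where
`ξ = (1 - b) * D - s` increases with `D`. -/
lemma IsBellmanPair.tip_short {q ε σ δ b D : ℝ} (h : IsBellmanPair q ε σ δ)
    (hb : b * q ^ 2 = 1) (hD0 : 0 ≤ D) (hD : D ≤ q * ε)
    (hξ : σ + √((1 - b) * δ ^ 2 + b * σ ^ 2 - b * (1 - b) * D ^ 2) ≤ (1 - b) * D) :
    (1 - b) * profile δ ≤
      Real.exp (b * D) * profile (√((1 - b) * δ ^ 2 + b * σ ^ 2 - b * (1 - b) * D ^ 2)) -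
        b * (Real.exp D * profile σ) := by
  have hq : 0 < q := one_pos.trans h.one_lt
  have hb0 : 0 < b := by
    by_contra hc
    nlinarith [sq_pos_of_pos hq]
  have hb1 : b < 1 := by nlinarith [h.one_lt]
  have hσ := h.sigma_nonneg
  let R : ℝ → ℝ := fun x => (1 - b) * δ ^ 2 + b * σ ^ 2 - b * (1 - b) * x ^ 2
  let S : ℝ → ℝ := fun x => √(R x)
  let P : ℝ → ℝ := fun x => Real.exp (b * x) * profile (S x) - b * (Real.exp x * profile σ)
  let ξ : ℝ → ℝ := fun x => (1 - b) * x - S x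
  have hRcont : Continuous R := by fun_prop
  have hScont : Continuous S := hRcont.sqrt
  have hξcont : Continuous ξ := by fun_prop
  have hPcont : Continuous P := by
    have := continuous_profile.comp hScont
    simp only [P]
    fun_prop
  have hRend : R (q * ε) = σ ^ 2 := by
    simp only [R]
    linear_combination (1 - b) * h.sq_eq - (1 - b) * ε ^ 2 * hb
  have hRanti : ∀ x y, 0 ≤ x → x < y → R y < R x := by
    intro x y hx hxy
    have : x ^ 2 < y ^ 2 := by nlinarith
    have h2 : 0 < b * (1 - b) := mul_pos hb0 (by linarith)
    simp only [R]
    nlinarith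
  have hSanti : ∀ x y, 0 ≤ x → x ≤ y → S y ≤ S x := by
    intro x y hx hxy
    rcases hxy.eq_or_lt with rfl | hlt
    · exact le_rfl
    · exact Real.sqrt_le_sqrt (hRanti x y hx hlt).le
  have hξmono : ∀ x y, 0 ≤ x → x ≤ y → ξ x ≤ ξ y := by
    intro x y hx hxy
    have := hSanti x y hx hxy
    simp only [ξ]
    nlinarith
  have hderiv : ∀ x, 0 ≤ x → x < q * ε →
      HasDerivAt P (b * Real.exp x * (profile (-ξ x) - profile σ)) x := by
    intro x hx0 hx
    have hRx : 0 < R x := by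
      have := hRanti x _ hx0 hx
      rw [hRend] at this
      nlinarith [sq_nonneg σ]
    have hSpos : 0 < S x := Real.sqrt_pos.2 hRx
    have hR' : HasDerivAt R (-(b * (1 - b) * (2 * x))) x := by
      refine (((hasDerivAt_pow 2 x).const_mul (b * (1 - b))).const_sub _).congr_deriv ?_
      simp
    have hS' := hR'.sqrt hRx.ne'
    have e1 : HasDerivAt (fun x => Real.exp (b * x)) (Real.exp (b * x) * b) x := by
      simpa using ((hasDerivAt_id x).const_mul b).exp
    have := (e1.mul ((hasDerivAt_profile (S x)).comp x hS')).sub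
      (((Real.hasDerivAt_exp x).mul_const (profile σ)).const_mul b)
    refine this.congr_deriv ?_
    have h1 : Real.exp (b * x) * Real.exp (S x) = Real.exp x * Real.exp (-ξ x) := by
      rw [← Real.exp_add, ← Real.exp_add]
      simp only [ξ]
      ring_nf
    have h2 : -S x * Real.exp (S x) * (-(b * (1 - b) * (2 * x)) / (2 * √(R x))) =
        b * (1 - b) * x * Real.exp (S x) := by
      have : √(R x) = S x := rfl
      rw [this]
      field_simp
    simp only [Function.comp_apply]
    rw [h2]
    have h3 : profile (-ξ x) = (1 + (1 - b) * x - S x) * Real.exp (-ξ x) := by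
      simp only [profile, ξ]; ring
    rw [h3]
    have h4 : profile (S x) = (1 - S x) * Real.exp (S x) := rfl
    rw [h4]
    linear_combination b * (1 - S x + (1 - b) * x) * h1
  change (1 - b) * profile δ ≤ P D
  have hξD : σ ≤ ξ D := by simp only [ξ, S, R]; linarith
  rcases le_or_gt (profile (-ξ D)) (profile σ) with hc | hc
  · -- beyond `D` the derivative stays nonpositive, so `P` decreases to its value at `q * ε`
    have hanti : AntitoneOn P (Set.Icc D (q * ε)) := by
      refine antitoneOn_of_deriv_nonpos (convex_Icc _ _) hPcont.continuousOn ?_ ?_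
      · rw [interior_Icc]
        exact fun x hx => (hderiv x (by linarith [hx.1]) hx.2).differentiableAt.differentiableWithinAt
      · rw [interior_Icc]
        intro x hx
        have hx0 : 0 ≤ x := by linarith [hx.1]
        rw [(hderiv x hx0 hx.2).deriv]
        have h1 := hξmono D x hD0 hx.1.le
        have h2 : profile (-ξ x) ≤ profile (-ξ D) :=
          profile_monotoneOn (Set.mem_Iic.2 (by linarith)) (Set.mem_Iic.2 (by linarith))
            (by linarith)
        exact mul_nonpos_of_nonneg_of_nonpos (by positivity) (by linarith)
    have := hanti ⟨le_rfl, hD⟩ ⟨hD, le_rfl⟩ hD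
    refine le_trans (le_of_eq ?_) this
    simp only [P, S]
    rw [hRend, Real.sqrt_sq hσ, h.endpoint hb]
  · -- `P` increases from the point `D₁` with `ξ D₁ = σ`, where both gaps are nonnegative
    obtain ⟨D₁, hD₁, hξ₁⟩ : σ ∈ ξ '' Set.Icc 0 D := by
      refine intermediate_value_Icc hD0 hξcont.continuousOn ⟨?_, hξD⟩
      have : 0 ≤ S 0 := Real.sqrt_nonneg _
      simp only [ξ]
      linarith
    have hmono : MonotoneOn P (Set.Icc D₁ D) := by
      refine monotoneOn_of_deriv_nonneg (convex_Icc _ _) hPcont.continuousOn ?_ ?_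
      · rw [interior_Icc]
        exact fun x hx => (hderiv x (by linarith [hx.1, hD₁.1])
          (by linarith [hx.2])).differentiableAt.differentiableWithinAt
      · rw [interior_Icc]
        intro x hx
        have hx0 : 0 ≤ x := by linarith [hx.1, hD₁.1]
        rw [(hderiv x hx0 (by linarith [hx.2])).deriv]
        have h0 := hξmono D₁ x hD₁.1 hx.1.le
        have h1 := hξmono x D hx0 hx.2.le
        have h2 : profile (-ξ D) ≤ profile (-ξ x) :=
          profile_monotoneOn (Set.mem_Iic.2 (by linarith)) (Set.mem_Iic.2 (by linarith))
            (by linarith)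
        exact mul_nonneg (by positivity) (by linarith)
    refine le_trans ?_ (hmono ⟨le_rfl, hD₁.2⟩ ⟨hD₁.2, le_rfl⟩ hD₁.2)
    have hR1 : 0 ≤ R D₁ := by
      rcases (hD₁.2.trans hD).eq_or_lt with he | hlt
      · rw [he, hRend]; positivity
      · have := hRanti _ _ hD₁.1 hlt
        rw [hRend] at this
        nlinarith [sq_nonneg σ]
    have hS1 : S D₁ ^ 2 = R D₁ := Real.sq_sqrt hR1
    have hS0 : 0 ≤ S D₁ := Real.sqrt_nonneg _
    have hid := binary_defect_eq (β := b) (D := D₁) (s := S D₁) (ry := σ) (rz := δ)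
      (by rw [hS1]; simp only [R]; ring)
    have g1 : 0 ≤ tangentGap (S D₁ - (1 - b) * D₁) σ :=
      tangentGap_nonneg hσ (by simp only [ξ] at hξ₁; linarith)
    have g2 : 0 ≤ tangentGap (S D₁ + b * D₁) δ :=
      tangentGap_nonneg h.delta_nonneg (by
        have := mul_nonneg hb0.le hD₁.1
        linarith [h.delta_nonneg])
    have g3 : 0 ≤ Real.exp (b * D₁) * (Real.exp (S D₁) * (b * tangentGap (S D₁ - (1 - b) * D₁) σ +
        (1 - b) * tangentGap (S D₁ + b * D₁) δ)) := by
      have : 0 ≤ 1 - b := by linarith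
      positivity
    rw [← hid] at g3
    have e1 : Real.exp (b * D₁) * Real.exp ((1 - b) * D₁) = Real.exp D₁ := by
      rw [← Real.exp_add]; ring_nf
    have e2 : Real.exp (b * D₁) * Real.exp (-(b * D₁)) = 1 := by
      rw [← Real.exp_add]; simp
    simp only [P]
    rw [← e1]
    linear_combination g3 - (1 - b) * profile δ * e2

/-- The case of a base point of variance `ε²` and a distance at least the extremal one; the right
side increases with `D` from the extremal configuration. -/
lemma IsBellmanPair.tip_long {q ε σ δ b D : ℝ} (h : IsBellmanPair q ε σ δ)
    (hb : b * q ^ 2 = 1) (hD : q * ε ≤ D) :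
    (1 - b) * profile δ ≤ Real.exp (b * D) * profile σ -
      b * (Real.exp D * profile (√(δ ^ 2 - q ^ 2 * ε ^ 2 + (1 - b) * D ^ 2))) := by
  have hq : 0 < q := one_pos.trans h.one_lt
  have hb0 : 0 < b := by
    by_contra hc
    nlinarith [sq_pos_of_pos hq]
  have hb1 : b < 1 := by nlinarith [h.one_lt]
  have hσ := h.sigma_nonneg
  have hqε : 0 ≤ q * ε := mul_nonneg hq.le h.eps_nonneg
  let R : ℝ → ℝ := fun x => δ ^ 2 - q ^ 2 * ε ^ 2 + (1 - b) * x ^ 2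
  let S : ℝ → ℝ := fun x => √(R x)
  let P : ℝ → ℝ := fun x => Real.exp (b * x) * profile σ - b * (Real.exp x * profile (S x))
  have hRcont : Continuous R := by fun_prop
  have hScont : Continuous S := hRcont.sqrt
  have hPcont : Continuous P := by
    have := continuous_profile.comp hScont
    simp only [P]
    fun_prop
  have hRend : R (q * ε) = σ ^ 2 := by
    simp only [R]
    linear_combination h.sq_eq - ε ^ 2 * hb
  have hRmono : ∀ x, q * ε < x → σ ^ 2 < R x := by
    intro x hx
    rw [← hRend]
    have : (q * ε) ^ 2 < x ^ 2 := by nlinarith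
    simp only [R]
    nlinarith
  have hmono : MonotoneOn P (Set.Ici (q * ε)) := by
    have hderiv : ∀ x, q * ε < x → HasDerivAt P
        (b * (Real.exp (b * x) * profile σ - Real.exp ((b * x)) * profile (S x + (1 - b) * x))) x := by
      intro x hx
      have hRx : 0 < R x := (sq_nonneg σ).trans_lt (hRmono x hx)
      have hSpos : 0 < S x := Real.sqrt_pos.2 hRx
      have hR' : HasDerivAt R ((1 - b) * (2 * x)) x := by
        refine (((hasDerivAt_pow 2 x).const_mul (1 - b)).const_add _).congr_deriv ?_
        simp
      have hS' := hR'.sqrt hRx.ne'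
      have e1 : HasDerivAt (fun x => Real.exp (b * x)) (Real.exp (b * x) * b) x := by
        simpa using ((hasDerivAt_id x).const_mul b).exp
      have := (e1.mul_const (profile σ)).sub (((Real.hasDerivAt_exp x).mul
        ((hasDerivAt_profile (S x)).comp x hS')).const_mul b)
      refine this.congr_deriv ?_
      have h1 : Real.exp (b * x) * Real.exp (S x + (1 - b) * x) =
          Real.exp x * Real.exp (S x) := by
        rw [← Real.exp_add, ← Real.exp_add]
        ring_nf
      have h2 : -S x * Real.exp (S x) * ((1 - b) * (2 * x) / (2 * √(R x))) =
          -((1 - b) * x * Real.exp (S x)) := by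
        have : √(R x) = S x := rfl
        rw [this]
        field_simp
      simp only [Function.comp_apply]
      rw [h2]
      simp only [profile]
      linear_combination b * (1 - (S x + (1 - b) * x)) * h1
    refine monotoneOn_of_deriv_nonneg (convex_Ici _) hPcont.continuousOn ?_ ?_
    · rw [interior_Ici]
      exact fun x hx => (hderiv x hx).differentiableAt.differentiableWithinAt
    · rw [interior_Ici]
      intro x hx
      rw [(hderiv x hx).deriv]
      have hSσ : σ ≤ S x := Real.le_sqrt_of_sq_le (hRmono x hx).le
      have hx0 : 0 ≤ (1 - b) * x := mul_nonneg (by linarith) (hqε.trans (le_of_lt hx))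
      have h2 : profile (S x + (1 - b) * x) ≤ profile σ :=
        profile_antitoneOn (Set.mem_Ici.2 hσ) (Set.mem_Ici.2 (by linarith)) (by linarith)
      have := mul_le_mul_of_nonneg_left h2 (Real.exp_pos (b * x)).le
      exact mul_nonneg hb0.le (by linarith)
  refine le_trans (le_of_eq ?_) (hmono (Set.mem_Ici.2 le_rfl) (Set.mem_Ici.2 hD) hD)
  simp only [P, S]
  rw [hRend, Real.sqrt_sq hσ, h.endpoint hb]

/-- The two-point inequality for weight `b = 1 / q ^ 2` and a constant lower part, when the tip lies
far from the base point. Raising the variance of the tip until it or the variance of the base point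
reaches `ε²` leads to one of the two extreme cases. -/
lemma IsBellmanPair.tip {q ε σ δ b D r s : ℝ} (h : IsBellmanPair q ε σ δ)
    (hb : b * q ^ 2 = 1) (hD0 : 0 ≤ D) (hr : σ ≤ r) (hs : σ ≤ s)
    (hrel : b * r ^ 2 + (1 - b) * δ ^ 2 = s ^ 2 + b * (1 - b) * D ^ 2)
    (hbad : s + r ≤ (1 - b) * D) :
    (1 - b) * profile δ ≤ Real.exp (b * D) * profile s - b * (Real.exp D * profile r) := by
  have hq : 0 < q := one_pos.trans h.one_lt
  have hb0 : 0 < b := by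
    by_contra hc
    nlinarith [sq_pos_of_pos hq]
  have hb1 : b < 1 := by nlinarith [h.one_lt]
  have hσ := h.sigma_nonneg
  rcases le_total D (q * ε) with hD | hD
  · -- the tip reaches variance `ε²` first
    set R := (1 - b) * δ ^ 2 + b * σ ^ 2 - b * (1 - b) * D ^ 2 with hR
    have hRs : R = s ^ 2 - b * (r ^ 2 - σ ^ 2) := by rw [hR]; linear_combination hrel
    have hR0 : σ ^ 2 ≤ R := by
      have h1 : b * (1 - b) * D ^ 2 ≤ b * (1 - b) * (q * ε) ^ 2 := by
        have : 0 ≤ b * (1 - b) := mul_nonneg hb0.le (by linarith)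
        gcongr
      have h2 : (1 - b) * δ ^ 2 + b * σ ^ 2 - b * (1 - b) * (q * ε) ^ 2 = σ ^ 2 := by
        linear_combination (1 - b) * h.sq_eq - (1 - b) * ε ^ 2 * hb
      linarith
    have hsq : √R ^ 2 = R := Real.sq_sqrt ((sq_nonneg σ).trans hR0)
    have hle : √R ≤ s := by
      refine Real.sqrt_le_iff.2 ⟨by linarith, ?_⟩
      rw [hRs]
      have : 0 ≤ b * (r ^ 2 - σ ^ 2) := mul_nonneg hb0.le (by nlinarith)
      linarith
    refine (h.tip_short hb hD0 hD (by rw [← hR]; linarith)).trans ?_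
    rw [← hR]
    exact exp_profile_sub_mono hb0.le hσ (Real.sqrt_nonneg _) hr hle
      (by rw [hsq, hRs]; ring) (by linarith)
  · -- the base point reaches variance `ε²` first
    set R := δ ^ 2 - q ^ 2 * ε ^ 2 + (1 - b) * D ^ 2 with hR
    have hRr : b * R = b * r ^ 2 - (s ^ 2 - σ ^ 2) := by
      rw [hR]
      linear_combination -hrel - ε ^ 2 * hb + h.sq_eq
    have hR0 : 0 ≤ R := by
      have h1 : (q * ε) ^ 2 ≤ D ^ 2 := by
        have := mul_nonneg hq.le h.eps_nonneg
        gcongr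
      have h2 : δ ^ 2 - q ^ 2 * ε ^ 2 + (1 - b) * (q * ε) ^ 2 = σ ^ 2 := by
        linear_combination h.sq_eq - ε ^ 2 * hb
      nlinarith [sq_nonneg σ]
    have hsq : √R ^ 2 = R := Real.sq_sqrt hR0
    have hle : √R ≤ r := by
      refine Real.sqrt_le_iff.2 ⟨by linarith, ?_⟩
      nlinarith
    refine (h.tip_long hb hD).trans ?_
    rw [← hR]
    exact exp_profile_sub_mono hb0.le (Real.sqrt_nonneg _) hσ hle hs
      (by rw [hsq]; linear_combination hRr) (by linarith [Real.sqrt_nonneg R])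

/-! ### The main inequality for the Bellman function -/

/-- The two-point inequality for weights at least `1 / q ^ 2`, in the heights `√(δ² - v)`. Only the
gap of the upper point can be negative; then `tangentGap_comparison` replaces the lower point by a
constant one of weight `1 - 1 / q ^ 2`. -/
lemma IsBellmanPair.binary_profile {q ε σ δ β D s ry rz : ℝ} (h : IsBellmanPair q ε σ δ)
    (hβ : 1 ≤ β * q ^ 2) (hβ' : 1 ≤ (1 - β) * q ^ 2) (hD : 0 ≤ D) (hs : σ ≤ s) (hry : σ ≤ ry)
    (hrz : σ ≤ rz) (hrzδ : rz ≤ δ)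
    (hrel : β * ry ^ 2 + (1 - β) * rz ^ 2 = s ^ 2 + β * (1 - β) * D ^ 2) :
    β * (Real.exp ((1 - β) * D) * profile ry) + (1 - β) * (Real.exp (-(β * D)) * profile rz) ≤
      profile s := by
  have hq : 0 < q := one_pos.trans h.one_lt
  have hq2 : 0 < q ^ 2 := by positivity
  have hβ0 : 0 < β := by
    by_contra hc
    nlinarith
  have hβ1 : 0 < 1 - β := by
    by_contra hc
    nlinarith
  have hσ := h.sigma_nonneg
  rw [← sub_nonneg, binary_defect_eq hrel]
  refine mul_nonneg (Real.exp_pos s).le ?_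
  have hβD : 0 ≤ β * D := mul_nonneg hβ0.le hD
  have gz : 0 ≤ tangentGap (s + β * D) rz := tangentGap_nonneg (by linarith) (by linarith)
  rcases le_or_gt (-ry) (s - (1 - β) * D) with hcase | hcase
  · have gy := tangentGap_nonneg (hσ.trans hry) hcase
    positivity
  obtain ⟨A, hA⟩ : ∃ A, s - (1 - β) * D = -A := ⟨(1 - β) * D - s, by ring⟩
  have hAry : ry < A := by linarith
  obtain ⟨b, hb⟩ : ∃ b, b * q ^ 2 = 1 := ⟨(q ^ 2)⁻¹, by field_simp⟩
  have hb0 : 0 < b := by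
    by_contra hc
    nlinarith
  have hbβ : b ≤ β := by
    by_contra hc
    nlinarith
  have hb1 : 0 < 1 - b := by linarith
  set M := A ^ 2 - ry ^ 2 with hMdef
  have hM : 0 ≤ M := by nlinarith
  set l₁ := (1 - β) / β with hl₁
  set l₂ := (1 - b) / b with hl₂
  have hl₁pos : 0 < l₁ := div_pos hβ1 hβ0
  have hl₂pos : 0 < l₂ := div_pos hb1 hb0
  have hl : l₁ ≤ l₂ := by
    rw [hl₁, hl₂, div_le_div_iff₀ hβ0 hb0]
    nlinarith
  set az := s + β * D with haz
  have haz0 : 0 ≤ az := by linarith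
  have hazA : (1 - β) * az = s + β * A := by
    have : A = (1 - β) * D - s := by linarith
    rw [haz, this]; ring
  have hrz2 : az ^ 2 + M / l₁ = rz ^ 2 := by
    have hAeq : A = (1 - β) * D - s := by linarith
    rw [hl₁, div_div_eq_mul_div]
    field_simp
    rw [hMdef, haz, hAeq]
    linear_combination -hrel
  have hrz_eq : √(az ^ 2 + M / l₁) = rz := by rw [hrz2, Real.sqrt_sq (by linarith)]
  have hMl : M / l₂ ≤ M / l₁ := div_le_div_of_nonneg_left hM hl₁pos hl
  have hrzδ2 : rz ^ 2 ≤ δ ^ 2 := by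
    have : 0 ≤ rz := hσ.trans hrz
    gcongr
  set a₂ := √(δ ^ 2 - M / l₂) with ha₂
  have hle2 : az ^ 2 ≤ δ ^ 2 - M / l₂ := by linarith
  have haz_le : az ≤ a₂ := Real.le_sqrt_of_sq_le hle2
  have ha₂0 : 0 ≤ a₂ := Real.sqrt_nonneg _
  have ha₂sq : a₂ ^ 2 + M / l₂ = δ ^ 2 := by
    rw [ha₂, Real.sq_sqrt ((sq_nonneg az).trans hle2)]; ring
  have hcomp := tangentGap_comparison haz0 ha₂0 hl₁pos hl
    (mul_le_mul hl haz_le haz0 hl₂pos.le) hM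
  rw [hrz_eq, ha₂sq, Real.sqrt_sq h.delta_nonneg] at hcomp
  -- the base point of the comparison configuration
  set s₂ := (1 - b) * (A + a₂) - A with hs₂
  have hss : s ≤ s₂ := by
    have h1 : (1 - b) * ((1 - β) * az) ≤ (1 - β) * ((1 - b) * a₂) := by
      have := mul_le_mul_of_nonneg_left haz_le (mul_nonneg hβ1.le hb1.le)
      linarith
    rw [hazA] at h1
    have h2 : (1 - β) * s₂ = (1 - β) * ((1 - b) * a₂) - (1 - β) * (b * A) := by rw [hs₂]; ring
    have h3 : 0 ≤ (β - b) * (s + A) := mul_nonneg (by linarith) (by linarith)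
    have h4 : (1 - β) * s ≤ (1 - β) * s₂ := by rw [h2]; linarith
    exact le_of_mul_le_mul_left h4 hβ1
  have hMb : b * M = (1 - b) * (δ ^ 2 - a₂ ^ 2) := by
    rw [← ha₂sq, hl₂]
    field_simp
    ring
  have hrel₂ : b * ry ^ 2 + (1 - b) * δ ^ 2 = s₂ ^ 2 + b * (1 - b) * (A + a₂) ^ 2 := by
    rw [hMdef] at hMb
    rw [hs₂]
    linear_combination -hMb
  have htip := h.tip hb (D := A + a₂) (by linarith) hry (by linarith : σ ≤ s₂) hrel₂ (by linarith)
  have hdef := binary_defect_eq hrel₂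
  have hnn : 0 ≤ b * tangentGap (s₂ - (1 - b) * (A + a₂)) ry +
      (1 - b) * tangentGap (s₂ + b * (A + a₂)) δ := by
    have e1 : Real.exp (-(b * (A + a₂))) * Real.exp (A + a₂) = Real.exp ((1 - b) * (A + a₂)) := by
      rw [← Real.exp_add]; ring_nf
    have e2 : Real.exp (-(b * (A + a₂))) * Real.exp (b * (A + a₂)) = 1 := by
      rw [← Real.exp_add]; simp
    have := mul_le_mul_of_nonneg_left htip (Real.exp_pos (-(b * (A + a₂)))).le
    have h0 : 0 ≤ Real.exp s₂ * (b * tangentGap (s₂ - (1 - b) * (A + a₂)) ry +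
        (1 - b) * tangentGap (s₂ + b * (A + a₂)) δ) := by
      rw [← hdef, ← e1]
      linear_combination this + profile s₂ * e2
    exact nonneg_of_mul_nonneg_right h0 (Real.exp_pos _)
  rw [show s₂ - (1 - b) * (A + a₂) = -A by rw [hs₂]; ring,
    show s₂ + b * (A + a₂) = a₂ by rw [hs₂]; ring] at hnn
  rw [hA]
  have h5 : l₂ * b = 1 - b := by rw [hl₂]; field_simp
  have h6 : l₁ * β = 1 - β := by rw [hl₁]; field_simp
  have h7 : 0 ≤ b * (tangentGap (-A) ry + l₂ * tangentGap a₂ δ) := by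
    rw [← h5] at hnn
    linarith
  have h8 := nonneg_of_mul_nonneg_right h7 hb0
  rw [← h6]
  have := mul_nonneg hβ0.le (h8.trans (add_le_add_right hcomp _))
  linarith

/-- The Bellman function at mean `m` and variance `v`, not normalized: at `v = 0` it equals
`exp m * profile δ`. -/
noncomputable def envelope (δ m v : ℝ) : ℝ := Real.exp m * profile (√(δ ^ 2 - v))

lemma IsBellmanPair.envelope_le {q ε σ δ m v : ℝ} (h : IsBellmanPair q ε σ δ) (hv : v ≤ ε ^ 2) :
    envelope δ m v ≤ Real.exp m * profile σ := by
  unfold envelope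
  gcongr
  exact profile_antitoneOn (Set.mem_Ici.2 h.sigma_nonneg) (Set.mem_Ici.2 (Real.sqrt_nonneg _))
    (Real.le_sqrt_of_sq_le (by linarith [h.sq_eq]))

lemma IsBellmanPair.le_envelope {q ε σ δ m v : ℝ} (h : IsBellmanPair q ε σ δ) (hv : 0 ≤ v) :
    Real.exp m * profile δ ≤ envelope δ m v := by
  unfold envelope
  gcongr
  refine profile_antitoneOn (Set.mem_Ici.2 (Real.sqrt_nonneg _)) (Set.mem_Ici.2 h.delta_nonneg)
    (Real.sqrt_le_iff.2 ⟨h.delta_nonneg, by linarith⟩)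

lemma IsBellmanPair.envelope_binary {q ε σ δ β m₁ m₂ v₁ v₂ : ℝ} (h : IsBellmanPair q ε σ δ)
    (hβ : 1 ≤ β * q ^ 2) (hβ' : 1 ≤ (1 - β) * q ^ 2)
    (hv₁ : 0 ≤ v₁) (hv₁' : v₁ ≤ ε ^ 2) (hv₂ : 0 ≤ v₂) (hv₂' : v₂ ≤ ε ^ 2)
    (hv : β * v₁ + (1 - β) * v₂ + β * (1 - β) * (m₁ - m₂) ^ 2 ≤ ε ^ 2) :
    β * envelope δ m₁ v₁ + (1 - β) * envelope δ m₂ v₂ ≤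
      envelope δ (β * m₁ + (1 - β) * m₂)
        (β * v₁ + (1 - β) * v₂ + β * (1 - β) * (m₁ - m₂) ^ 2) := by
  wlog hm : m₂ ≤ m₁ generalizing β m₁ m₂ v₁ v₂
  · have := this (β := 1 - β) (m₁ := m₂) (m₂ := m₁) hβ' (by simpa using hβ) hv₂ hv₂' hv₁ hv₁'
      (by rw [sub_sub_cancel]; convert hv using 1; ring) (by linarith)
    rw [sub_sub_cancel] at this
    convert this using 1
    · ring
    · congr 1 <;> ring
  set v := β * v₁ + (1 - β) * v₂ + β * (1 - β) * (m₁ - m₂) ^ 2 with hvdef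
  have hsq : ∀ w, w ≤ ε ^ 2 → √(δ ^ 2 - w) ^ 2 = δ ^ 2 - w := fun w hw =>
    Real.sq_sqrt (by nlinarith [h.sq_eq, sq_nonneg σ])
  have hge : ∀ w, w ≤ ε ^ 2 → σ ≤ √(δ ^ 2 - w) := fun w hw =>
    Real.le_sqrt_of_sq_le (by linarith [h.sq_eq])
  have key := h.binary_profile hβ hβ' (D := m₁ - m₂) (by linarith) (hge v hv) (hge v₁ hv₁')
    (hge v₂ hv₂') (Real.sqrt_le_iff.2 ⟨h.delta_nonneg, by linarith⟩)
    (by rw [hsq v hv, hsq v₁ hv₁', hsq v₂ hv₂', hvdef]; ring)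
  have := mul_le_mul_of_nonneg_left key (Real.exp_pos (β * m₁ + (1 - β) * m₂)).le
  unfold envelope
  refine le_trans (le_of_eq ?_) this
  have e1 : Real.exp m₁ = Real.exp (β * m₁ + (1 - β) * m₂) * Real.exp ((1 - β) * (m₁ - m₂)) := by
    rw [← Real.exp_add]; ring_nf
  have e2 : Real.exp m₂ = Real.exp (β * m₁ + (1 - β) * m₂) * Real.exp (-(β * (m₁ - m₂))) := by
    rw [← Real.exp_add]; ring_nf
  rw [e1, e2]
  ring

/-- The main inequality for at most `q ^ 2` equal weights. By averaging, some `i` can be removed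
without increasing the variance of the family, so that the induction stays in the domain
`V ≤ ε ^ 2`. -/
lemma IsBellmanPair.envelope_sum_le {ι : Type*} [DecidableEq ι] {q ε σ δ : ℝ}
    (h : IsBellmanPair q ε σ δ) (m v : ι → ℝ) (hv : ∀ i, 0 ≤ v i) (hv' : ∀ i, v i ≤ ε ^ 2)
    (k : ℕ) (t : Finset ι) (hk : t.card = k + 1) (hkq : (k + 1 : ℝ) ≤ q ^ 2) (μ V : ℝ)
    (hμ : ∑ i ∈ t, m i = (k + 1) * μ)
    (hV : ∑ i ∈ t, (v i + (m i - μ) ^ 2) = (k + 1) * V) (hVε : V ≤ ε ^ 2) :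
    ∑ i ∈ t, envelope δ (m i) (v i) ≤ (k + 1) * envelope δ μ V := by
  induction k generalizing t μ V with
  | zero =>
    obtain ⟨i, rfl⟩ := Finset.card_eq_one.1 hk
    simp only [Finset.sum_singleton, Nat.cast_zero, zero_add, one_mul] at hμ hV ⊢
    rw [← hV, ← hμ]
    simp
  | succ k ih =>
    push_cast at hkq hμ hV ⊢
    have hk0 : (0 : ℝ) ≤ k := k.cast_nonneg
    -- the left side is `k + 1` times the variance of the family with `i` removed
    obtain ⟨i, hi, hVi⟩ : ∃ i ∈ t,
        (k + 2) * V - v i - (k + 2) / (k + 1) * (m i - μ) ^ 2 ≤ (k + 1) * V := by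
      refine Finset.exists_le_of_sum_le (Finset.card_pos.1 (by omega)) ?_
      rw [Finset.sum_sub_distrib, Finset.sum_sub_distrib, Finset.sum_const, Finset.sum_const,
        ← Finset.mul_sum, hk, nsmul_eq_mul, nsmul_eq_mul]
      rw [Finset.sum_add_distrib] at hV
      have h1 : 0 ≤ ∑ i ∈ t, (m i - μ) ^ 2 := Finset.sum_nonneg fun i _ => sq_nonneg _
      have h2 : 1 * ∑ i ∈ t, (m i - μ) ^ 2 ≤ ((k : ℝ) + 2) / (k + 1) * ∑ i ∈ t, (m i - μ) ^ 2 := by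
        gcongr
        rw [le_div_iff₀ (by positivity)]
        linarith
      push_cast
      nlinarith
    have hcard : (t.erase i).card = k + 1 := by
      rw [Finset.card_erase_of_mem hi, hk]; rfl
    set μ' := μ - (m i - μ) / (k + 1) with hμ'
    set V' := ((k + 2) * V - v i - (k + 2) / (k + 1) * (m i - μ) ^ 2) / (k + 1) with hV'
    have hsum : ∀ f : ι → ℝ, ∑ j ∈ t, f j = f i + ∑ j ∈ t.erase i, f j := fun f =>
      (Finset.add_sum_erase t f hi).symm
    rw [hsum] at hμ hV ⊢
    have hμ2 : ∑ j ∈ t.erase i, m j = (k + 1) * μ' := by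
      rw [hμ']
      field_simp
      linarith
    have hV2 : ∑ j ∈ t.erase i, (v j + (m j - μ') ^ 2) = (k + 1) * V' := by
      have : ∀ j, v j + (m j - μ') ^ 2 =
          (v j + (m j - μ) ^ 2) + 2 * (μ - μ') * m j + (μ' ^ 2 - μ ^ 2) := fun j => by ring
      rw [Finset.sum_congr rfl fun j _ => this j, Finset.sum_add_distrib, Finset.sum_add_distrib,
        ← Finset.mul_sum, hμ2, Finset.sum_const, hcard, nsmul_eq_mul]
      have h3 := eq_sub_of_add_eq' hV
      rw [h3, hV', hμ']
      push_cast
      field_simp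
      ring
    have hV'le : V' ≤ V := by
      rw [hV', div_le_iff₀ (by positivity)]
      linarith
    have hV'0 : 0 ≤ V' := by
      have : 0 ≤ (k + 1) * V' := by
        rw [← hV2]
        exact Finset.sum_nonneg fun j _ => add_nonneg (hv j) (sq_nonneg _)
      exact nonneg_of_mul_nonneg_right this (by positivity)
    have hrest := ih (t.erase i) hcard (by linarith) μ' V' hμ2 hV2 (hV'le.trans hVε)
    set β : ℝ := 1 / (k + 2) with hβ
    have hβ1 : 1 - β = (k + 1) / (k + 2) := by rw [hβ]; field_simp; ring
    have hVeq : β * v i + (1 - β) * V' + β * (1 - β) * (m i - μ') ^ 2 = V := by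
      rw [hβ1, hβ, hV', hμ']
      field_simp
      ring
    have hμeq : β * m i + (1 - β) * μ' = μ := by
      rw [hβ1, hβ, hμ']
      field_simp
      ring
    have hbin := h.envelope_binary (β := β) (m₁ := m i) (m₂ := μ') (v₁ := v i) (v₂ := V')
      (by rw [hβ, div_mul_eq_mul_div, one_mul, le_div_iff₀ (by positivity)]; linarith)
      (by
        rw [hβ1, div_mul_eq_mul_div, le_div_iff₀ (by positivity)]
        nlinarith)
      (hv i) (hv' i) hV'0 (hV'le.trans hVε) (by rw [hVeq]; exact hVε)
    rw [hVeq, hμeq] at hbin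
    have h4 := mul_le_mul_of_nonneg_left hbin (by positivity : (0 : ℝ) ≤ k + 2)
    have h5 : ((k : ℝ) + 2) * (β * envelope δ (m i) (v i) + (1 - β) * envelope δ μ' V') =
        envelope δ (m i) (v i) + (k + 1) * envelope δ μ' V' := by
      rw [hβ1, hβ]
      field_simp
    rw [h5] at h4
    have h6 : ((k : ℝ) + 1 + 1) = k + 2 := by ring
    rw [h6]
    linarith

/-- With `X = (q - 1) * ε` this makes the sharp constant at least `exp (-ε) / (1 - ε)`, the value of
`profile σ / profile δ` at `δ = ε`. -/
lemma exp_quadratic_gap {q X : ℝ} (hq : 0 < q) (hX : 0 ≤ X) :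
    0 ≤ Real.exp X + (q ^ 2 - 1) - (q + 1) * X - q ^ 2 * Real.exp (-(X / q)) := by
  have h1 := Real.quadratic_le_exp_of_nonneg hX
  have h2 := exp_neg_le_quadratic (t := X / q) (by positivity)
  have h3 := mul_le_mul_of_nonneg_left h2 (sq_nonneg q)
  have h4 : q ^ 2 * (1 - X / q + (X / q) ^ 2 / 2) = q ^ 2 - q * X + X ^ 2 / 2 := by
    field_simp
  linarith

/-- The pair exists below the threshold, by the intermediate value theorem for `δ` between `ε`, where
`σ = 0`, and `1`. -/
lemma exists_isBellmanPair {q ε : ℝ} (hq : 1 < q) (hε : 0 ≤ ε)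
    (hden : 0 < q ^ 2 * Real.exp (ε / q) - Real.exp (q * ε)) :
    ∃ σ δ, IsBellmanPair q ε σ δ := by
  have hq0 : 0 < q := one_pos.trans hq
  set d := q ^ 2 * Real.exp (ε / q) - Real.exp (q * ε) with hd
  have hgap := exp_quadratic_gap hq0 (X := (q - 1) * ε) (mul_nonneg (by linarith) hε)
  have hdle : d ≤ (q ^ 2 - 1) * profile ε := by
    have h1 := mul_nonneg (Real.exp_pos ε).le hgap
    have e1 : Real.exp ε * Real.exp ((q - 1) * ε) = Real.exp (q * ε) := by
      rw [← Real.exp_add]; ring_nf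
    have e2 : Real.exp ε * Real.exp (-((q - 1) * ε / q)) = Real.exp (ε / q) := by
      rw [← Real.exp_add]
      congr 1
      field_simp
      ring
    rw [hd]
    unfold profile
    linear_combination h1 + e1 - q ^ 2 * e2
  have hq1 : 0 < q ^ 2 - 1 := by nlinarith
  have hε1 : ε < 1 := by
    by_contra hc
    have : profile ε ≤ 0 :=
      mul_nonpos_of_nonpos_of_nonneg (by linarith) (Real.exp_pos _).le
    nlinarith
  -- for `ε = 0` the equation holds for every `δ`, and the root found below could be `δ = 1`
  rcases hε.eq_or_lt with rfl | hεpos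
  · refine ⟨0, 0, hq, le_rfl, le_rfl, le_rfl, one_pos, by simp, by simp [profile]⟩
  let f : ℝ → ℝ := fun x => profile (√(x ^ 2 - ε ^ 2)) * d - (q ^ 2 - 1) * profile x
  have hf : Continuous f := by
    have h1 := continuous_profile
    have h2 : Continuous fun x : ℝ => √(x ^ 2 - ε ^ 2) := by fun_prop
    have h3 := h1.comp h2
    exact (h3.mul continuous_const).sub (continuous_const.mul h1)
  have hf1 : 0 < f 1 := by
    have h1 : √(1 ^ 2 - ε ^ 2) < 1 := by
      rw [Real.sqrt_lt' one_pos]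
      nlinarith
    have h2 : f 1 = profile (√(1 ^ 2 - ε ^ 2)) * d := by simp [f, profile]
    rw [h2]
    exact mul_pos (profile_pos h1) hden
  obtain ⟨δ, hδ, hfδ⟩ : (0 : ℝ) ∈ f '' Set.Icc ε 1 := by
    refine intermediate_value_Icc hε1.le hf.continuousOn ⟨?_, hf1.le⟩
    have : f ε = d - (q ^ 2 - 1) * profile ε := by simp [f, profile]
    rw [this]
    linarith
  have hδ1 : δ < 1 := lt_of_le_of_ne hδ.2 (by rintro rfl; linarith)
  refine ⟨√(δ ^ 2 - ε ^ 2), δ, hq, hε, Real.sqrt_nonneg _, hε.trans hδ.1, hδ1, ?_, ?_⟩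
  · rw [Real.sq_sqrt (by nlinarith [hδ.1])]
    ring
  · simp only [f] at hfδ
    rw [← hd]
    linarith

/-! ### Half-open dyadic cubes, means and variances -/

/-- The corner of the half-open dyadic cube of side length `2 ^ (-k)` that contains `x`. -/
noncomputable def cellIndex {n : ℕ} (k : ℤ) (x : Fin n → ℝ) : Fin n → ℤ :=
  fun i => ⌊(2 : ℝ) ^ k * x i⌋

/-- The half-open version of `dyadicCube k m`; unlike the open cubes, those of one scale partition
the space. -/
def cell {n : ℕ} (k : ℤ) (m : Fin n → ℤ) : Set (Fin n → ℝ) := cellIndex k ⁻¹' {m}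

lemma mem_cell {n : ℕ} {k : ℤ} {m : Fin n → ℤ} {x : Fin n → ℝ} :
    x ∈ cell k m ↔ cellIndex k x = m := Iff.rfl

lemma measurable_cellIndex {n : ℕ} (k : ℤ) : Measurable (cellIndex (n := n) k) :=
  measurable_pi_lambda _ fun i => Int.measurable_floor.comp ((measurable_pi_apply i).const_mul _)

lemma measurableSet_cell {n : ℕ} (k : ℤ) (m : Fin n → ℤ) : MeasurableSet (cell k m) :=
  measurable_cellIndex k (measurableSet_singleton m)

lemma cell_eq_pi {n : ℕ} (k : ℤ) (m : Fin n → ℤ) :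
    cell k m = Set.univ.pi fun i =>
      Set.Ico ((m i : ℝ) * (2 : ℝ) ^ (-k)) (((m i : ℝ) + 1) * (2 : ℝ) ^ (-k)) := by
  ext x
  have h2 : (0 : ℝ) < 2 ^ k := by positivity
  simp only [mem_cell, funext_iff, cellIndex, Int.floor_eq_iff, Set.mem_univ_pi, Set.mem_Ico,
    zpow_neg, ← div_eq_mul_inv, div_le_iff₀ h2, lt_div_iff₀ h2, mul_comm]

lemma dyadicCube_ae_eq_cell {n : ℕ} (k : ℤ) (m : Fin n → ℤ) :
    dyadicCube k m =ᵐ[volume] cell k m := by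
  rw [cell_eq_pi, dyadicCube, volume_pi]
  exact Measure.univ_pi_Ioo_ae_eq_Icc.trans Measure.univ_pi_Ico_ae_eq_Icc.symm

lemma volume_cell {n : ℕ} (k : ℤ) (m : Fin n → ℤ) :
    volume (cell k m) = ENNReal.ofReal (((2 : ℝ) ^ (-k)) ^ n) := by
  rw [cell_eq_pi, Real.volume_pi_Ico]
  have : ∀ i : Fin n, ((m i : ℝ) + 1) * (2 : ℝ) ^ (-k) - (m i : ℝ) * (2 : ℝ) ^ (-k) =
    (2 : ℝ) ^ (-k) := fun i => by ring
  simp only [this, Finset.prod_const, Finset.card_univ, Fintype.card_fin]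
  rw [ENNReal.ofReal_pow (by positivity)]

lemma volume_real_cell {n : ℕ} (k : ℤ) (m : Fin n → ℤ) :
    volume.real (cell k m) = ((2 : ℝ) ^ (-k)) ^ n := by
  rw [Measure.real, volume_cell, ENNReal.toReal_ofReal (by positivity)]

lemma volume_cell_ne_top {n : ℕ} (k : ℤ) (m : Fin n → ℤ) : volume (cell k m) ≠ ∞ := by
  simp [volume_cell]

lemma volume_cell_ne_zero {n : ℕ} (k : ℤ) (m : Fin n → ℤ) : volume (cell k m) ≠ 0 := by
  rw [volume_cell]
  have : (0 : ℝ) < ((2 : ℝ) ^ (-k)) ^ n := by positivity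
  simpa using this

/-- The corners of the `2 ^ n` subcubes of `cell k m` at scale `k + 1`. -/
def child {n : ℕ} (m : Fin n → ℤ) (c : Fin n → Fin 2) : Fin n → ℤ := fun i => 2 * m i + (c i : ℕ)

lemma child_injective {n : ℕ} (m : Fin n → ℤ) : Function.Injective (child m) := by
  intro c c' h
  funext i
  have := congrFun h i
  simp only [child] at this
  exact Fin.ext (by omega)

lemma cellIndex_succ_bounds {n : ℕ} (k : ℤ) (x : Fin n → ℝ) (i : Fin n) :
    2 * cellIndex k x i ≤ cellIndex (k + 1) x i ∧
      cellIndex (k + 1) x i < 2 * cellIndex k x i + 2 := by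
  have h : (2 : ℝ) ^ (k + 1) * x i = 2 * ((2 : ℝ) ^ k * x i) := by
    rw [zpow_add_one₀ two_ne_zero]; ring
  simp only [cellIndex, h]
  set y := (2 : ℝ) ^ k * x i
  have h1 := Int.floor_le y
  have h2 := Int.lt_floor_add_one y
  constructor
  · rw [Int.le_floor]; push_cast; linarith
  · rw [Int.floor_lt]; push_cast; linarith

lemma cell_eq_iUnion_child {n : ℕ} (k : ℤ) (m : Fin n → ℤ) :
    cell k m = ⋃ c, cell (k + 1) (child m c) := by
  ext x
  simp only [Set.mem_iUnion, mem_cell]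
  constructor
  · rintro rfl
    have h := cellIndex_succ_bounds k x
    refine ⟨fun i => ⟨(cellIndex (k + 1) x i - 2 * cellIndex k x i).toNat, ?_⟩, ?_⟩
    · have := h i; omega
    · funext i
      simp only [child]
      have := h i; omega
  · rintro ⟨c, hc⟩
    funext i
    have h := cellIndex_succ_bounds k x i
    rw [hc] at h
    simp only [child] at h
    have := (c i).isLt
    omega

lemma pairwise_disjoint_child {n : ℕ} (k : ℤ) (m : Fin n → ℤ) :
    Pairwise (Function.onFun Disjoint fun c => cell (k + 1) (child m c)) := by
  intro c c' hcc
  refine Set.disjoint_left.2 fun x hx hx' => hcc (child_injective m ?_)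
  rw [mem_cell] at hx hx'
  exact hx.symm.trans hx'

lemma setIntegral_cell_eq_sum {n : ℕ} {k : ℤ} {m : Fin n → ℤ} {f : (Fin n → ℝ) → ℝ}
    (hf : IntegrableOn f (cell k m)) :
    ∫ x in cell k m, f x = ∑ c, ∫ x in cell (k + 1) (child m c), f x := by
  rw [cell_eq_iUnion_child] at hf ⊢
  exact integral_iUnion_fintype (fun c => measurableSet_cell _ _) (pairwise_disjoint_child k m)
    fun c => hf.mono_set (Set.subset_iUnion (fun c => cell (k + 1) (child m c)) c)

lemma setLIntegral_cell_eq_sum {n : ℕ} (k : ℤ) (m : Fin n → ℤ) (f : (Fin n → ℝ) → ℝ≥0∞) :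
    ∫⁻ x in cell k m, f x = ∑ c, ∫⁻ x in cell (k + 1) (child m c), f x := by
  rw [cell_eq_iUnion_child, lintegral_iUnion (fun c => measurableSet_cell _ _)
    (pairwise_disjoint_child k m), tsum_fintype]

lemma volume_real_cell_succ {n : ℕ} (k : ℤ) (m m' : Fin n → ℤ) :
    volume.real (cell k m) = 2 ^ n * volume.real (cell (k + 1) m') := by
  rw [volume_real_cell, volume_real_cell, ← mul_pow, neg_add, zpow_add₀ two_ne_zero]
  congr 1
  rw [zpow_neg_one]
  ring

lemma ae_tendsto_cell_average {n : ℕ} {f : (Fin n → ℝ) → ℝ} (hf : LocallyIntegrable f volume)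
    (k : ℤ) :
    ∀ᵐ x, Filter.Tendsto (fun j : ℕ => ⨍ y in cell (k + j) (cellIndex (k + j) x), f y)
      Filter.atTop (nhds (f x)) := by
  filter_upwards [IsUnifLocDoublingMeasure.ae_tendsto_average volume hf 1] with x hx
  let r : ℕ → ℝ := fun j => (2 : ℝ) ^ (-(k + j)) / 2
  let w : ℕ → Fin n → ℝ := fun j i => ((cellIndex (k + j) x i : ℝ) + 1 / 2) * (2 : ℝ) ^ (-(k + j))
  have hr0 : ∀ j, 0 < r j := fun j => by positivity
  have hrt : Filter.Tendsto r Filter.atTop (nhdsWithin 0 (Set.Ioi 0)) := by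
    refine tendsto_nhdsWithin_iff.2 ⟨?_, Filter.Eventually.of_forall hr0⟩
    have h1 : r = fun j => (2 : ℝ) ^ (-k) / 2 * (1 / 2) ^ j := by
      funext j
      simp only [r]
      rw [neg_add, zpow_add₀ two_ne_zero, zpow_neg _ (j : ℤ), zpow_natCast, one_div, inv_pow]
      ring
    rw [h1]
    simpa using (tendsto_pow_atTop_nhds_zero_of_lt_one (r := (1 / 2 : ℝ)) (by norm_num)
      (by norm_num)).const_mul ((2 : ℝ) ^ (-k) / 2)
  have hball : ∀ j, Metric.closedBall (w j) (r j) = Set.univ.pi fun i =>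
      Set.Icc ((cellIndex (k + j) x i : ℝ) * (2 : ℝ) ^ (-(k + j)))
        (((cellIndex (k + j) x i : ℝ) + 1) * (2 : ℝ) ^ (-(k + j))) := by
    intro j
    rw [closedBall_pi _ (hr0 j).le]
    refine congrArg _ (funext fun i => ?_)
    rw [Real.closedBall_eq_Icc]
    congr 1 <;> simp only [w, r] <;> ring
  have hcell : ∀ j : ℕ, cell (k + j) (cellIndex (k + j) x) =ᵐ[volume] Metric.closedBall (w j) (r j) := by
    intro j
    rw [hball, cell_eq_pi, volume_pi, Set.pi_univ_Icc]
    exact Measure.univ_pi_Ico_ae_eq_Icc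
  have hmem : ∀ j, x ∈ Metric.closedBall (w j) (1 * r j) := by
    intro j
    rw [one_mul, hball]
    have : x ∈ cell (k + j) (cellIndex (k + j) x) := rfl
    rw [cell_eq_pi] at this
    exact fun i hi => Set.Ico_subset_Icc_self (this i hi)
  refine (hx w r hrt (Filter.Eventually.of_forall hmem)).congr fun j => ?_
  exact (setAverage_congr (hcell j)).symm

/-- The average of `φ` over a dyadic cube. -/
noncomputable def cellMean {n : ℕ} (φ : (Fin n → ℝ) → ℝ) (k : ℤ) (m : Fin n → ℤ) : ℝ :=
  ⨍ x in cell k m, φ x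

/-- The variance of `φ` over a dyadic cube. -/
noncomputable def cellVar {n : ℕ} (φ : (Fin n → ℝ) → ℝ) (k : ℤ) (m : Fin n → ℤ) : ℝ :=
  ⨍ x in cell k m, (φ x - cellMean φ k m) ^ 2

lemma setIntegral_cell_eq {n : ℕ} (f : (Fin n → ℝ) → ℝ) (k : ℤ) (m : Fin n → ℤ) :
    ∫ x in cell k m, f x = volume.real (cell k m) * ⨍ x in cell k m, f x := by
  have : volume.real (cell k m) ≠ 0 := by rw [volume_real_cell]; positivity
  rw [setAverage_eq, smul_eq_mul]
  field_simp

lemma oscillation_two_dyadicCube {n : ℕ} (φ : (Fin n → ℝ) → ℝ) (k : ℤ) (m : Fin n → ℤ) :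
    oscillation 2 (dyadicCube k m) φ =
      (∫⁻ x in cell k m, ENNReal.ofReal ((φ x - cellMean φ k m) ^ 2)) / volume (cell k m) := by
  rw [oscillation, setLAverage_congr (dyadicCube_ae_eq_cell k m), setLAverage_eq,
    setAverage_congr (dyadicCube_ae_eq_cell k m), cellMean]
  simp only [Real.rpow_two, sq_abs]

/-- The norm bound in terms of half-open cubes and without fractional powers or averages. -/
lemma bmoNorm_le_iff {n : ℕ} {φ : (Fin n → ℝ) → ℝ} {ε : ℝ} (hε : 0 ≤ ε) :
    bmoNorm φ ≤ ENNReal.ofReal ε ↔ ∀ (k : ℤ) (m : Fin n → ℤ),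
      ∫⁻ x in cell k m, ENNReal.ofReal ((φ x - cellMean φ k m) ^ 2) ≤
        ENNReal.ofReal (ε ^ 2) * volume (cell k m) := by
  have key : ∀ (k : ℤ) (m : Fin n → ℤ), oscillation 2 (dyadicCube k m) φ ^ ((1 : ℝ) / 2) ≤
      ENNReal.ofReal ε ↔ ∫⁻ x in cell k m, ENNReal.ofReal ((φ x - cellMean φ k m) ^ 2) ≤
        ENNReal.ofReal (ε ^ 2) * volume (cell k m) := by
    intro k m
    rw [oscillation_two_dyadicCube, one_div, ENNReal.rpow_inv_le_iff (by norm_num : (0 : ℝ) < 2),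
      ENNReal.div_le_iff (volume_cell_ne_zero k m) (volume_cell_ne_top k m),
      ENNReal.rpow_two, ENNReal.ofReal_pow hε]
  simp only [← key]
  rw [bmoNorm, iSup₂_le_iff]
  constructor
  · exact fun h k m => h _ ⟨k, m, rfl⟩
  · rintro h J ⟨k, m, rfl⟩
    exact h k m

lemma integrableOn_cell {n : ℕ} {φ : (Fin n → ℝ) → ℝ} (hφ : LocallyIntegrable φ volume) (k : ℤ)
    (m : Fin n → ℤ) : IntegrableOn φ (cell k m) := by
  have h : IntegrableOn φ (Set.Icc (fun i => (m i : ℝ) * (2 : ℝ) ^ (-k))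
      (fun i => ((m i : ℝ) + 1) * (2 : ℝ) ^ (-k))) := hφ.integrableOn_isCompact isCompact_Icc
  refine h.mono_set ?_
  rw [cell_eq_pi, ← Set.pi_univ_Icc]
  exact Set.pi_mono fun i _ => Set.Ico_subset_Icc_self

section bmo
variable {n : ℕ} {φ : (Fin n → ℝ) → ℝ} {ε : ℝ}

lemma integrableOn_cell_sq_sub (hε : 0 ≤ ε) (hφ : φ ∈ bmoBall n ε) (k : ℤ) (m : Fin n → ℤ) :
    IntegrableOn (fun x => (φ x - cellMean φ k m) ^ 2) (cell k m) := by
  have h1 := integrableOn_cell hφ.1 k m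
  refine ⟨(h1.aestronglyMeasurable.sub aestronglyMeasurable_const).pow 2, ?_⟩
  rw [hasFiniteIntegral_iff_ofReal (Filter.Eventually.of_forall fun x => sq_nonneg _)]
  refine ((bmoNorm_le_iff hε).1 hφ.2 k m).trans_lt ?_
  exact ENNReal.mul_lt_top ENNReal.ofReal_lt_top (volume_cell_ne_top k m).lt_top

lemma cellVar_nonneg (k : ℤ) (m : Fin n → ℤ) : 0 ≤ cellVar φ k m := by
  rw [cellVar, setAverage_eq]
  exact mul_nonneg (by positivity) (integral_nonneg fun x => sq_nonneg _)

lemma cellVar_le (hε : 0 ≤ ε) (hφ : φ ∈ bmoBall n ε) (k : ℤ) (m : Fin n → ℤ) :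
    cellVar φ k m ≤ ε ^ 2 := by
  have h := (bmoNorm_le_iff hε).1 hφ.2 k m
  rw [← ofReal_integral_eq_lintegral_ofReal (integrableOn_cell_sq_sub hε hφ k m)
    (Filter.Eventually.of_forall fun x => sq_nonneg _), volume_cell,
    ← ENNReal.ofReal_mul (sq_nonneg ε), ENNReal.ofReal_le_ofReal_iff (by positivity),
    ← volume_real_cell k m, setIntegral_cell_eq, mul_comm] at h
  exact le_of_mul_le_mul_right h (by rw [volume_real_cell]; positivity)

lemma setIntegral_cell_sq_sub (hε : 0 ≤ ε) (hφ : φ ∈ bmoBall n ε) (k : ℤ) (m : Fin n → ℤ)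
    (a : ℝ) : ∫ x in cell k m, (φ x - a) ^ 2 =
      volume.real (cell k m) * (cellVar φ k m + (cellMean φ k m - a) ^ 2) := by
  have h1 := integrableOn_cell_sq_sub hε hφ k m
  have h2 := (integrableOn_cell hφ.1 k m).const_mul (2 * (cellMean φ k m - a))
  have h3 : IntegrableOn (fun _ => a ^ 2 - cellMean φ k m ^ 2) (cell k m) volume :=
    integrableOn_const (volume_cell_ne_top k m)
  have e : ∀ x, (φ x - a) ^ 2 = (φ x - cellMean φ k m) ^ 2 + 2 * (cellMean φ k m - a) * φ x +
      (a ^ 2 - cellMean φ k m ^ 2) := fun x => by ring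
  simp only [e]
  have i1 := integral_add (h1.add h2) h3
  simp only [Pi.add_apply] at i1
  rw [i1, integral_add h1 h2, integral_const_mul, setIntegral_const,
    setIntegral_cell_eq, setIntegral_cell_eq φ, smul_eq_mul]
  change _ * cellVar φ k m + _ * (_ * cellMean φ k m) + _ = _
  ring

lemma sum_cellMean_child (hφ : LocallyIntegrable φ volume) (k : ℤ) (m : Fin n → ℤ) :
    ∑ c, cellMean φ (k + 1) (child m c) = 2 ^ n * cellMean φ k m := by
  have h := setIntegral_cell_eq_sum (integrableOn_cell hφ k m)
  simp only [setIntegral_cell_eq φ] at h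
  have hw : ∀ c, volume.real (cell (k + 1) (child m c)) = volume.real (cell (k + 1) m) := fun c => by
    rw [volume_real_cell, volume_real_cell]
  have hw0 : 0 < volume.real (cell (k + 1) m) := by rw [volume_real_cell]; positivity
  simp only [hw] at h
  rw [← Finset.mul_sum, volume_real_cell_succ k m m] at h
  refine mul_left_cancel₀ hw0.ne' ?_
  unfold cellMean
  linarith

lemma sum_cellVar_child (hε : 0 ≤ ε) (hφ : φ ∈ bmoBall n ε) (k : ℤ) (m : Fin n → ℤ) :
    ∑ c, (cellVar φ (k + 1) (child m c) +
      (cellMean φ (k + 1) (child m c) - cellMean φ k m) ^ 2) = 2 ^ n * cellVar φ k m := by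
  have h := setIntegral_cell_eq_sum (integrableOn_cell_sq_sub hε hφ k m)
  simp only [setIntegral_cell_sq_sub hε hφ] at h
  have hw : ∀ c, volume.real (cell (k + 1) (child m c)) = volume.real (cell (k + 1) m) := fun c => by
    rw [volume_real_cell, volume_real_cell]
  have hw0 : 0 < volume.real (cell (k + 1) m) := by rw [volume_real_cell]; positivity
  simp only [hw] at h
  rw [← Finset.mul_sum, volume_real_cell_succ k m m] at h
  refine mul_left_cancel₀ hw0.ne' ?_
  linarith

end bmo

/-! ### The upper bound -/

lemma envelope_children_le {n : ℕ} {φ : (Fin n → ℝ) → ℝ} {q ε σ δ : ℝ}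
    (h : IsBellmanPair q ε σ δ) (hq : q ^ 2 = 2 ^ n) (hφ : φ ∈ bmoBall n ε) (k : ℤ)
    (m : Fin n → ℤ) :
    ∑ c, envelope δ (cellMean φ (k + 1) (child m c)) (cellVar φ (k + 1) (child m c)) ≤
      2 ^ n * envelope δ (cellMean φ k m) (cellVar φ k m) := by
  have hN : ((2 ^ n - 1 : ℕ) : ℝ) + 1 = 2 ^ n := by
    have : 1 ≤ 2 ^ n := Nat.one_le_two_pow
    push_cast [this]
    ring
  have hε := h.eps_nonneg
  have := h.envelope_sum_le (fun c => cellMean φ (k + 1) (child m c))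
    (fun c => cellVar φ (k + 1) (child m c)) (fun c => cellVar_nonneg _ _)
    (fun c => cellVar_le hε hφ _ _) (2 ^ n - 1) Finset.univ
    (by simp [Nat.sub_add_cancel Nat.one_le_two_pow]) (by rw [hN, hq])
    (cellMean φ k m) (cellVar φ k m) (by rw [hN]; exact sum_cellMean_child hφ.1 k m)
    (by rw [hN]; exact sum_cellVar_child hε hφ k m) (cellVar_le hε hφ k m)
  rwa [hN] at this

/-- The main inequality iterated over `j` generations. -/
lemma setLIntegral_exp_cellMean_le {n : ℕ} {φ : (Fin n → ℝ) → ℝ} {q ε σ δ : ℝ}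
    (h : IsBellmanPair q ε σ δ) (hq : q ^ 2 = 2 ^ n) (hφ : φ ∈ bmoBall n ε) (j : ℕ) (k : ℤ)
    (m : Fin n → ℤ) :
    ∫⁻ x in cell k m, ENNReal.ofReal (Real.exp (cellMean φ (k + j) (cellIndex (k + j) x))) ≤
      ENNReal.ofReal (volume.real (cell k m) *
        (envelope δ (cellMean φ k m) (cellVar φ k m) / profile δ)) := by
  have hδ := profile_pos h.delta_lt_one
  induction j generalizing k m with
  | zero =>
    have : ∀ x ∈ cell k m, ENNReal.ofReal (Real.exp (cellMean φ (k + (0 : ℕ))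
        (cellIndex (k + (0 : ℕ)) x))) = ENNReal.ofReal (Real.exp (cellMean φ k m)) := by
      intro x hx
      rw [mem_cell] at hx
      simp [hx]
    rw [setLIntegral_congr_fun (measurableSet_cell k m) this, setLIntegral_const, mul_comm,
      ENNReal.ofReal_mul (by positivity), ofReal_measureReal (volume_cell_ne_top k m)]
    gcongr
    rw [le_div_iff₀ hδ]
    exact h.le_envelope (cellVar_nonneg k m)
  | succ j ih =>
    have hk : k + ((j + 1 : ℕ) : ℤ) = k + 1 + (j : ℕ) := by push_cast; ring
    have hnn : ∀ k (m : Fin n → ℤ), 0 ≤ envelope δ (cellMean φ k m) (cellVar φ k m) := fun k m =>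
      le_trans (by positivity) (h.le_envelope (cellVar_nonneg k m))
    simp only [hk]
    rw [setLIntegral_cell_eq_sum]
    refine (Finset.sum_le_sum fun c _ => ih (k + 1) (child m c)).trans ?_
    rw [← ENNReal.ofReal_sum_of_nonneg fun c _ =>
      mul_nonneg (by positivity) (div_nonneg (hnn _ _) hδ.le)]
    refine ENNReal.ofReal_le_ofReal ?_
    have hw : ∀ c, volume.real (cell (k + 1) (child m c)) = volume.real (cell (k + 1) m) :=
      fun c => by rw [volume_real_cell, volume_real_cell]
    simp only [hw]
    rw [← Finset.mul_sum, ← Finset.sum_div, volume_real_cell_succ k m m]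
    have := envelope_children_le h hq hφ k m
    calc _ ≤ volume.real (cell (k + 1) m) *
          ((2 ^ n * envelope δ (cellMean φ k m) (cellVar φ k m)) / profile δ) := by gcongr
      _ = _ := by ring

lemma IsBellmanPair.johnNirenberg {n : ℕ} {q ε σ δ : ℝ} (h : IsBellmanPair q ε σ δ)
    (hq : q ^ 2 = 2 ^ n) : JohnNirenberg n ε (profile σ / profile δ) := by
  rintro φ hφ Q ⟨k, m, rfl⟩
  have hδ := profile_pos h.delta_lt_one
  rw [setLAverage_congr (dyadicCube_ae_eq_cell k m), setAverage_congr (dyadicCube_ae_eq_cell k m),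
    setLAverage_eq, ENNReal.div_le_iff (volume_cell_ne_zero k m) (volume_cell_ne_top k m)]
  change _ ≤ ENNReal.ofReal (_ * Real.exp (cellMean φ k m)) * _
  let g : ℕ → (Fin n → ℝ) → ℝ≥0∞ := fun j x =>
    ENNReal.ofReal (Real.exp (cellMean φ (k + j) (cellIndex (k + j) x)))
  have hg : ∀ j, Measurable (g j) := fun j =>
    (measurable_of_countable (fun m : Fin n → ℤ =>
      ENNReal.ofReal (Real.exp (cellMean φ (k + j) m)))).comp (measurable_cellIndex (k + j))
  have hlim : ∀ᵐ x, ENNReal.ofReal (Real.exp (φ x)) =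
      Filter.liminf (fun j => g j x) Filter.atTop := by
    filter_upwards [ae_tendsto_cell_average hφ.1 k] with x hx
    refine (Filter.Tendsto.liminf_eq ?_).symm
    exact (ENNReal.continuous_ofReal.tendsto _).comp ((Real.continuous_exp.tendsto _).comp hx)
  calc ∫⁻ x in cell k m, ENNReal.ofReal (Real.exp (φ x))
      = ∫⁻ x in cell k m, Filter.liminf (fun j => g j x) Filter.atTop :=
        lintegral_congr_ae (ae_restrict_of_ae hlim)
    _ ≤ Filter.liminf (fun j => ∫⁻ x in cell k m, g j x) Filter.atTop := lintegral_liminf_le hg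
    _ ≤ Filter.liminf (fun _ : ℕ => ENNReal.ofReal (volume.real (cell k m) *
        (Real.exp (cellMean φ k m) * profile σ / profile δ))) Filter.atTop := by
        refine Filter.liminf_le_liminf (Filter.Eventually.of_forall fun j => ?_)
        refine (setLIntegral_exp_cellMean_le h hq hφ j k m).trans (ENNReal.ofReal_le_ofReal ?_)
        have := h.envelope_le (m := cellMean φ k m) (cellVar_le h.eps_nonneg hφ k m)
        gcongr
    _ = _ := by
        rw [Filter.liminf_const, ENNReal.ofReal_mul (by positivity),
          ofReal_measureReal (volume_cell_ne_top k m), mul_comm]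
        congr 2
        ring

/-! ### The extremal function -/

lemma mem_cell_zero {n : ℕ} {k : ℤ} {x : Fin n → ℝ} :
    x ∈ cell k 0 ↔ ∀ i, 0 ≤ x i ∧ x i < (2 : ℝ) ^ (-k) := by
  rw [cell_eq_pi]
  simp

lemma cell_zero_antitone {n : ℕ} : Antitone fun k : ℤ => cell (n := n) k 0 := by
  intro k l hkl x hx
  rw [mem_cell_zero] at hx ⊢
  exact fun i => ⟨(hx i).1, (hx i).2.trans_le (zpow_le_zpow_right₀ one_le_two (by omega))⟩

lemma exists_notMem_cell_zero {n : ℕ} (x : Fin n → ℝ) :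
    ∃ i : ℕ, x = 0 ∨ x ∉ cell ((i : ℤ) + 1) 0 := by
  by_contra! hc
  refine (hc 0).1 (funext fun c => ?_)
  have h0 := ((mem_cell_zero.1 (hc 0).2) c).1
  refine le_antisymm (le_of_forall_pos_le_add fun η hη => ?_) h0
  obtain ⟨i, hi⟩ := exists_pow_lt_of_lt_one hη (show (1 / 2 : ℝ) < 1 by norm_num)
  have h1 := ((mem_cell_zero.1 (hc i).2) c).2
  have h2 : (2 : ℝ) ^ (-((i : ℤ) + 1)) ≤ (1 / 2) ^ i := by
    rw [one_div, inv_pow, ← zpow_natCast, ← zpow_neg]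
    exact zpow_le_zpow_right₀ one_le_two (by omega)
  simp only [Pi.zero_apply, zero_add]
  linarith

open Classical in
/-- The index `i` with `x ∈ shell n i`, for `x ≠ 0` in the half-open unit cube. Outside that cube and
at the origin the value is `0`. -/
noncomputable def depth {n : ℕ} (x : Fin n → ℝ) : ℕ := Nat.find (exists_notMem_cell_zero x)

open Classical in
lemma measurable_depth {n : ℕ} : Measurable (depth (n := n)) := by
  refine measurable_find _ fun i => ?_
  exact (measurableSet_singleton (0 : Fin n → ℝ)).union (measurableSet_cell _ 0).compl

/-- The difference of the consecutive cubes `[0, 2 ^ (-i))ⁿ` and `[0, 2 ^ (-i - 1))ⁿ`. -/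
def shell (n : ℕ) (i : ℕ) : Set (Fin n → ℝ) := cell (i : ℤ) 0 \ cell ((i : ℤ) + 1) 0

lemma measurableSet_shell (n i : ℕ) : MeasurableSet (shell n i) :=
  (measurableSet_cell _ _).diff (measurableSet_cell _ _)

open Classical in
lemma depth_eq_of_mem_shell {n i : ℕ} {x : Fin n → ℝ} (hx : x ∈ shell n i) : depth x = i := by
  rw [depth, Nat.find_eq_iff]
  refine ⟨Or.inr hx.2, fun j hj => ?_⟩
  rintro (rfl | h)
  · refine hx.2 (mem_cell_zero.2 fun c => ⟨le_rfl, ?_⟩)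
    simp only [Pi.zero_apply]
    positivity
  · exact h (cell_zero_antitone (by omega : (j : ℤ) + 1 ≤ i) hx.1)

open Classical in
lemma depth_congr {n : ℕ} {x y : Fin n → ℝ} (hx : x ≠ 0) (hy : y ≠ 0)
    (h : ∀ i : ℤ, x ∈ cell i 0 ↔ y ∈ cell i 0) : depth x = depth y := by
  rw [depth, depth]
  congr 1
  funext i
  simp [hx, hy, h]

lemma mem_shell_depth {n : ℕ} {j : ℕ} {x : Fin n → ℝ} (hx : x ∈ cell (j : ℤ) 0) (hx0 : x ≠ 0) :
    ∃ i, x ∈ shell n (j + i) := by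
  by_contra! hc
  have hall : ∀ i : ℕ, x ∈ cell ((j + i : ℕ) : ℤ) 0 := by
    intro i
    induction i with
    | zero => simpa using hx
    | succ i ih =>
      by_contra hi
      exact hc i ⟨ih, fun h => hi (by push_cast at h ⊢; rwa [← add_assoc])⟩
  obtain ⟨i, hi⟩ := exists_notMem_cell_zero x
  refine (hi.resolve_left hx0) (cell_zero_antitone (by omega) (hall (i + 1)))

lemma cell_zero_ae_eq_iUnion_shell {n : ℕ} (hn : 1 ≤ n) (j : ℕ) :
    cell (j : ℤ) 0 =ᵐ[volume] ⋃ i, shell n (j + i) := by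
  have : Nonempty (Fin n) := ⟨⟨0, hn⟩⟩
  have h0 : volume ({0} : Set (Fin n → ℝ)) = 0 := measure_singleton 0
  refine Filter.EventuallyEq.symm (ae_eq_set.2 ⟨?_, ?_⟩)
  · rw [Set.sdiff_eq_empty.2, measure_empty]
    exact Set.iUnion_subset fun i => Set.sdiff_subset.trans (cell_zero_antitone (by omega))
  · refine measure_mono_null (fun x hx => ?_) h0
    by_contra hx0
    obtain ⟨i, hi⟩ := mem_shell_depth hx.1 hx0
    exact hx.2 (Set.mem_iUnion.2 ⟨i, hi⟩)

lemma pairwise_disjoint_shell (n j : ℕ) :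
    Pairwise (Function.onFun Disjoint fun i => shell n (j + i)) := by
  intro i i' hii
  refine Set.disjoint_left.2 fun x hx hx' => hii ?_
  have := (depth_eq_of_mem_shell hx).symm.trans (depth_eq_of_mem_shell hx')
  omega

lemma volume_real_cell_natCast {n : ℕ} {q : ℝ} (hq : q ^ 2 = 2 ^ n) (i : ℕ) (m : Fin n → ℤ) :
    volume.real (cell (i : ℤ) m) = ((q ^ 2)⁻¹) ^ i := by
  rw [volume_real_cell, hq, zpow_neg, zpow_natCast, inv_pow, inv_pow, ← pow_mul, ← pow_mul,
    mul_comm]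

lemma volume_shell {n : ℕ} {q : ℝ} (hq : q ^ 2 = 2 ^ n) (i : ℕ) :
    volume (shell n i) = ENNReal.ofReal (((q ^ 2)⁻¹) ^ i * (1 - (q ^ 2)⁻¹)) := by
  have hfin : volume (shell n i) ≠ ∞ :=
    ne_top_of_le_ne_top (volume_cell_ne_top i 0) (measure_mono Set.sdiff_subset)
  rw [← ofReal_measureReal hfin, shell, measureReal_sdiff (cell_zero_antitone (by omega))
    (measurableSet_cell _ _) (volume_cell_ne_top _ _)]
  have : ((i : ℤ) + 1) = ((i + 1 : ℕ) : ℤ) := by push_cast; rfl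
  rw [this, volume_real_cell_natCast hq, volume_real_cell_natCast hq]
  congr 1
  ring

/-- The integral of a function of `depth` over `[0, 2 ^ (-j))ⁿ`, given a telescoping form `T` of the
contributions of the shells. -/
lemma setLIntegral_depth {n : ℕ} (hn : 1 ≤ n) {q : ℝ} (hq : q ^ 2 = 2 ^ n) {F T : ℕ → ℝ}
    (hF : ∀ i, 0 ≤ F i)
    (hT : ∀ i, ((q ^ 2)⁻¹) ^ i * (1 - (q ^ 2)⁻¹) * F i = T i - T (i + 1))
    (hlim : Filter.Tendsto T Filter.atTop (nhds 0)) (j : ℕ) :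
    ∫⁻ x in cell (j : ℤ) (0 : Fin n → ℤ), ENNReal.ofReal (F (depth x)) = ENNReal.ofReal (T j) := by
  have hq1 : (1 : ℝ) ≤ q ^ 2 := by rw [hq]; exact one_le_pow₀ one_le_two
  have hw : ∀ i : ℕ, 0 ≤ ((q ^ 2)⁻¹) ^ i * (1 - (q ^ 2)⁻¹) := fun i =>
    mul_nonneg (by positivity) (sub_nonneg.2 (inv_le_one_of_one_le₀ hq1))
  rw [Measure.restrict_congr_set (cell_zero_ae_eq_iUnion_shell hn j),
    lintegral_iUnion (fun i => measurableSet_shell n (j + i)) (pairwise_disjoint_shell n j)]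
  have hterm : ∀ i, ∫⁻ x in shell n (j + i), ENNReal.ofReal (F (depth x)) =
      ENNReal.ofReal (T (j + i) - T (j + i + 1)) := by
    intro i
    rw [setLIntegral_congr_fun (measurableSet_shell n (j + i))
      (g := fun _ => ENNReal.ofReal (F (j + i)))
      (fun x hx => by simp only [depth_eq_of_mem_shell hx]),
      setLIntegral_const, volume_shell hq, ← ENNReal.ofReal_mul (hF _), ← hT, mul_comm]
  have hnn : ∀ i, 0 ≤ T (j + i) - T (j + i + 1) := fun i => by
    rw [← hT]; exact mul_nonneg (hw _) (hF _)
  have hsum : HasSum (fun i => T (j + i) - T (j + i + 1)) (T j) := by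
    rw [hasSum_iff_tendsto_nat_of_nonneg hnn]
    have h1 : ∀ M, ∑ i ∈ Finset.range M, (T (j + i) - T (j + i + 1)) = T j - T (j + M) := fun M =>
      Finset.sum_range_sub' (fun i => T (j + i)) M
    simp only [h1]
    have h2 := (Filter.tendsto_add_atTop_iff_nat j).2 hlim
    simpa [add_comm] using h2.const_sub (T j)
  simp only [hterm]
  rw [← ENNReal.ofReal_tsum_of_nonneg hnn hsum.summable, hsum.tsum_eq]

lemma tendsto_pow_mul_quadratic {ρ : ℝ} (h0 : 0 ≤ ρ) (h1 : ρ < 1) (a b c : ℝ) :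
    Filter.Tendsto (fun i : ℕ => ρ ^ i * (a * (i : ℝ) ^ 2 + b * i + c)) Filter.atTop (nhds 0) := by
  have habs : |ρ| < 1 := by rwa [abs_of_nonneg h0]
  have t2 := (tendsto_pow_const_mul_const_pow_of_abs_lt_one 2 habs).const_mul a
  have t1 := (tendsto_pow_const_mul_const_pow_of_abs_lt_one 1 habs).const_mul b
  have t0 := (tendsto_pow_const_mul_const_pow_of_abs_lt_one 0 habs).const_mul c
  have := (t2.add t1).add t0
  simp only [mul_zero, add_zero] at this
  refine this.congr fun i => ?_
  ring

/-- The extremal function: `i * (q ^ 2 - 1) * γ - γ` on the `i`-th shell, where `q ^ 2 = 2 ^ n`, and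
`0` off the unit cube. For `γ = ε / q` all cubes `[0, 2 ^ (-j))ⁿ` have variance `ε²`. -/
noncomputable def extremal (n : ℕ) (q γ : ℝ) (x : Fin n → ℝ) : ℝ :=
  (cell 0 0).indicator (fun x => (depth x : ℝ) * ((q ^ 2 - 1) * γ) - γ) x

section extremal
variable {n : ℕ} {q γ : ℝ}

lemma measurable_extremal : Measurable (extremal n q γ) := by
  refine Measurable.indicator ?_ (measurableSet_cell _ _)
  exact (measurable_of_countable (fun i : ℕ => (i : ℝ) * ((q ^ 2 - 1) * γ) - γ)).comp measurable_depth

lemma extremal_eq_of_mem {j : ℕ} {x : Fin n → ℝ} (hx : x ∈ cell (j : ℤ) 0) :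
    extremal n q γ x = (depth x : ℝ) * ((q ^ 2 - 1) * γ) - γ :=
  Set.indicator_of_mem (cell_zero_antitone (by omega : (0 : ℤ) ≤ j) hx) _

lemma inv_sq_lt_one (hq1 : 1 < q) : (q ^ 2)⁻¹ < 1 := inv_lt_one_of_one_lt₀ (by nlinarith)

lemma setLIntegral_extremal_add (hn : 1 ≤ n) (hq : q ^ 2 = 2 ^ n) (hq1 : 1 < q) (hγ : 0 ≤ γ)
    (j : ℕ) : ∫⁻ x in cell (j : ℤ) (0 : Fin n → ℤ), ENNReal.ofReal (extremal n q γ x + γ) =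
      ENNReal.ofReal (((q ^ 2)⁻¹) ^ j * (j * ((q ^ 2 - 1) * γ) + γ)) := by
  have hq2 : 0 < q ^ 2 - 1 := by nlinarith
  rw [setLIntegral_congr_fun (measurableSet_cell _ _)
    (g := fun x => ENNReal.ofReal ((fun i : ℕ => (i : ℝ) * ((q ^ 2 - 1) * γ)) (depth x)))
    (fun x hx => by simp only [extremal_eq_of_mem hx, sub_add_cancel])]
  refine setLIntegral_depth hn hq (F := fun i : ℕ => (i : ℝ) * ((q ^ 2 - 1) * γ))
    (T := fun i : ℕ => ((q ^ 2)⁻¹) ^ i * (i * ((q ^ 2 - 1) * γ) + γ))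
    (fun i => mul_nonneg i.cast_nonneg (mul_nonneg hq2.le hγ)) (fun i => ?_) ?_ j
  · have hρ : (q ^ 2)⁻¹ * q ^ 2 = 1 := inv_mul_cancel₀ (by positivity)
    push_cast
    rw [pow_succ]
    linear_combination ((q ^ 2)⁻¹) ^ i * γ * hρ
  · refine (tendsto_pow_mul_quadratic (by positivity) (inv_sq_lt_one hq1) 0 ((q ^ 2 - 1) * γ)
      γ).congr fun i => ?_
    ring

lemma integrableOn_extremal (hn : 1 ≤ n) (hq : q ^ 2 = 2 ^ n) (hq1 : 1 < q) (hγ : 0 ≤ γ)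
    (j : ℕ) : IntegrableOn (fun x => extremal n q γ x + γ) (cell (j : ℤ) 0) ∧
      0 ≤ᵐ[volume.restrict (cell (j : ℤ) 0)] fun x => extremal n q γ x + γ := by
  have hq2 : 0 < q ^ 2 - 1 := by nlinarith
  have hnn : 0 ≤ᵐ[volume.restrict (cell (j : ℤ) 0)] fun x => extremal n q γ x + γ := by
    filter_upwards [ae_restrict_mem (measurableSet_cell _ _)] with x hx
    rw [extremal_eq_of_mem hx]
    simp only [Pi.zero_apply, sub_add_cancel]
    positivity
  refine ⟨⟨(measurable_extremal.add_const γ).aestronglyMeasurable, ?_⟩, hnn⟩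
  rw [hasFiniteIntegral_iff_ofReal hnn, setLIntegral_extremal_add hn hq hq1 hγ]
  exact ENNReal.ofReal_lt_top

lemma integrableOn_extremal_cell (hn : 1 ≤ n) (hq : q ^ 2 = 2 ^ n) (hq1 : 1 < q) (hγ : 0 ≤ γ)
    (j : ℕ) : IntegrableOn (extremal n q γ) (cell (j : ℤ) 0) := by
  have h1 := (integrableOn_extremal hn hq hq1 hγ j).1
  have h2 : IntegrableOn (fun _ => γ) (cell (j : ℤ) (0 : Fin n → ℤ)) volume :=
    integrableOn_const (volume_cell_ne_top _ _)
  refine (h1.sub h2).congr (Filter.Eventually.of_forall fun x => ?_)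
  simp

lemma setIntegral_extremal (hn : 1 ≤ n) (hq : q ^ 2 = 2 ^ n) (hq1 : 1 < q) (hγ : 0 ≤ γ)
    (j : ℕ) : ∫ x in cell (j : ℤ) 0, extremal n q γ x =
      ((q ^ 2)⁻¹) ^ j * (j * ((q ^ 2 - 1) * γ)) := by
  have hq2 : 0 < q ^ 2 - 1 := by nlinarith
  have h2 : IntegrableOn (fun _ => γ) (cell (j : ℤ) (0 : Fin n → ℤ)) volume :=
    integrableOn_const (volume_cell_ne_top _ _)
  have h3 := integral_add (integrableOn_extremal_cell hn hq hq1 hγ j) h2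
  rw [integral_eq_lintegral_of_nonneg_ae (integrableOn_extremal hn hq hq1 hγ j).2
    (integrableOn_extremal hn hq hq1 hγ j).1.aestronglyMeasurable,
    setLIntegral_extremal_add hn hq hq1 hγ, ENNReal.toReal_ofReal (by positivity),
    setIntegral_const, volume_real_cell_natCast hq, smul_eq_mul] at h3
  linarith

lemma cellMean_extremal (hn : 1 ≤ n) (hq : q ^ 2 = 2 ^ n) (hq1 : 1 < q) (hγ : 0 ≤ γ)
    (j : ℕ) : cellMean (extremal n q γ) j 0 = j * ((q ^ 2 - 1) * γ) := by
  have hq0 : 0 < q := one_pos.trans hq1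
  rw [cellMean, setAverage_eq, setIntegral_extremal hn hq hq1 hγ, volume_real_cell_natCast hq,
    smul_eq_mul, inv_mul_cancel_left₀ (by positivity)]

lemma setLIntegral_extremal_sq_sub (hn : 1 ≤ n) (hq : q ^ 2 = 2 ^ n) (hq1 : 1 < q)
    (j : ℕ) (a : ℝ) :
    ∫⁻ x in cell (j : ℤ) (0 : Fin n → ℤ), ENNReal.ofReal ((extremal n q γ x - a) ^ 2) =
      ENNReal.ofReal (((q ^ 2)⁻¹) ^ j * ((j * ((q ^ 2 - 1) * γ) - a) ^ 2 + q ^ 2 * γ ^ 2)) := by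
  have hq0 : 0 < q := one_pos.trans hq1
  rw [setLIntegral_congr_fun (measurableSet_cell _ _)
    (g := fun x => ENNReal.ofReal
      ((fun i : ℕ => ((i : ℝ) * ((q ^ 2 - 1) * γ) - γ - a) ^ 2) (depth x)))
    (fun x hx => by simp only [extremal_eq_of_mem hx])]
  refine setLIntegral_depth hn hq (F := fun i : ℕ => ((i : ℝ) * ((q ^ 2 - 1) * γ) - γ - a) ^ 2)
    (T := fun i : ℕ => ((q ^ 2)⁻¹) ^ i *
    ((i * ((q ^ 2 - 1) * γ) - a) ^ 2 + q ^ 2 * γ ^ 2)) (fun i => sq_nonneg _) (fun i => ?_) ?_ j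
  · have hρ : (q ^ 2)⁻¹ * q ^ 2 = 1 := inv_mul_cancel₀ (by positivity)
    push_cast
    rw [pow_succ]
    linear_combination ((q ^ 2)⁻¹) ^ i *
      (2 * (i * ((q ^ 2 - 1) * γ) - a) * γ + (q ^ 2 - 1) * γ ^ 2) * hρ
  · refine (tendsto_pow_mul_quadratic (by positivity) (inv_sq_lt_one hq1)
      (((q ^ 2 - 1) * γ) ^ 2) (-2 * a * ((q ^ 2 - 1) * γ)) (a ^ 2 + q ^ 2 * γ ^ 2)).congr
        fun i => ?_
    ring

lemma setLIntegral_exp_extremal (hn : 1 ≤ n) (hq : q ^ 2 = 2 ^ n) (hq1 : 1 < q)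
    (hden : Real.exp ((q ^ 2 - 1) * γ) < q ^ 2) :
    ∫⁻ x in cell 0 (0 : Fin n → ℤ), ENNReal.ofReal (Real.exp (extremal n q γ x)) =
      ENNReal.ofReal ((q ^ 2 - 1) / (q ^ 2 * Real.exp γ - Real.exp (q ^ 2 * γ))) := by
  have hq0 : 0 < q := one_pos.trans hq1
  have hexp : Real.exp (q ^ 2 * γ) = Real.exp γ * Real.exp ((q ^ 2 - 1) * γ) := by
    rw [← Real.exp_add]; ring_nf
  set B := Real.exp ((q ^ 2 - 1) * γ) with hB
  have hd : 0 < q ^ 2 - B := by linarith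
  rw [hexp, show q ^ 2 * Real.exp γ - Real.exp γ * B = Real.exp γ * (q ^ 2 - B) by ring,
    show (0 : ℤ) = ((0 : ℕ) : ℤ) by rfl, setLIntegral_congr_fun (measurableSet_cell _ _)
    (g := fun x => ENNReal.ofReal
      ((fun i : ℕ => B ^ i * (Real.exp γ)⁻¹) (depth x)))
    (fun x hx => by
      simp only [extremal_eq_of_mem hx, Real.exp_sub, Real.exp_nat_mul, div_eq_mul_inv, hB])]
  rw [setLIntegral_depth hn hq (F := fun i : ℕ => B ^ i * (Real.exp γ)⁻¹)
    (T := fun i : ℕ => ((q ^ 2)⁻¹ * B) ^ i * ((q ^ 2 - 1) / (Real.exp γ * (q ^ 2 - B)))) (fun i => by positivity) (fun i => ?_) ?_ 0]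
  · simp
  · have h1 : (q ^ 2)⁻¹ * B < 1 := by rw [inv_mul_lt_iff₀ (by positivity)]; linarith
    simpa using (tendsto_pow_atTop_nhds_zero_of_lt_one (by positivity) h1).mul_const
      ((q ^ 2 - 1) / (Real.exp γ * (q ^ 2 - B)))
  · have hρ : (1 - (q ^ 2)⁻¹) * (Real.exp γ)⁻¹ =
        (1 - (q ^ 2)⁻¹ * B) * ((q ^ 2 - 1) / (Real.exp γ * (q ^ 2 - B))) := by
      field_simp
    rw [pow_succ, mul_pow]
    linear_combination ((q ^ 2)⁻¹) ^ i * B ^ i * hρ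

end extremal

/-- A dyadic cube with nonzero corner lies inside or outside each of the cubes `[0, 2 ^ (-i))ⁿ`. -/
lemma mem_cell_zero_iff_of_mem_cell {n : ℕ} {k : ℤ} {m : Fin n → ℤ} (hm : m ≠ 0)
    {x y : Fin n → ℝ} (hx : x ∈ cell k m) (hy : y ∈ cell k m) (i : ℤ) :
    x ∈ cell i 0 ↔ y ∈ cell i 0 := by
  rcases le_total k i with hki | hik
  · have : ∀ z ∈ cell k m, z ∉ cell i 0 := by
      intro z hz hz'
      have := cell_zero_antitone hki hz'
      rw [mem_cell] at hz this
      exact hm (hz.symm.trans this)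
    simp [this x hx, this y hy]
  · obtain ⟨p, rfl⟩ := Int.le.dest hik
    have key : ∀ z ∈ cell (i + p) m, z ∈ cell i 0 ↔ ∀ c, 0 ≤ m c ∧ m c < 2 ^ p := by
      intro z hz
      rw [mem_cell_zero]
      refine forall_congr' fun c => ?_
      have hzc : ⌊(2 : ℝ) ^ (i + (p : ℤ)) * z c⌋ = m c := congrFun hz c
      have h2 : (0 : ℝ) < 2 ^ (i + (p : ℤ)) := by positivity
      rw [← hzc, Int.floor_nonneg, Int.floor_lt]
      have e : ((2 ^ p : ℤ) : ℝ) = 2 ^ (i + (p : ℤ)) * 2 ^ (-i) := by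
        rw [← zpow_add₀ two_ne_zero]
        simp
      rw [e, mul_lt_mul_iff_right₀ h2, mul_nonneg_iff_of_pos_left h2]
    rw [key x hx, key y hy]

lemma extremal_eq_of_mem_cell {n : ℕ} {q γ : ℝ} {k : ℤ} {m : Fin n → ℤ} (hm : m ≠ 0)
    {x y : Fin n → ℝ} (hx : x ∈ cell k m) (hy : y ∈ cell k m) :
    extremal n q γ x = extremal n q γ y := by
  have h := mem_cell_zero_iff_of_mem_cell hm hx hy
  have h0 : ∀ z ∈ cell k m, z ≠ 0 := by
    rintro z hz rfl
    rw [mem_cell] at hz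
    refine hm (hz.symm.trans (funext fun i => ?_))
    simp [cellIndex]
  have hd := depth_congr (h0 x hx) (h0 y hy) h
  unfold extremal
  by_cases hc : x ∈ cell 0 0
  · rw [Set.indicator_of_mem hc, Set.indicator_of_mem ((h 0).1 hc), hd]
  · rw [Set.indicator_of_notMem hc, Set.indicator_of_notMem (mt (h 0).2 hc)]

lemma extremal_mem_bmoBall {n : ℕ} (hn : 1 ≤ n) {q ε : ℝ} (hq : q ^ 2 = 2 ^ n) (hq1 : 1 < q)
    (hε : 0 ≤ ε) : extremal n q (ε / q) ∈ bmoBall n ε := by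
  have hq0 : 0 < q := one_pos.trans hq1
  have hγ : 0 ≤ ε / q := by positivity
  have hεγ : q ^ 2 * (ε / q) ^ 2 = ε ^ 2 := by field_simp
  set γ := ε / q with hγdef
  have hint0 : IntegrableOn (extremal n q γ) (cell 0 0) :=
    integrableOn_extremal_cell hn hq hq1 hγ 0
  have hsupp : ∀ x ∉ cell 0 0, extremal n q γ x = 0 := fun x hx => Set.indicator_of_notMem hx _
  refine ⟨(integrableOn_iff_integrable_of_support_subset (s := cell 0 0) ?_).1 hint0
    |>.locallyIntegrable, ?_⟩
  · intro x hx
    by_contra hc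
    exact hx (hsupp x hc)
  rw [bmoNorm_le_iff hε]
  intro k m
  -- the cubes `[0, 2 ^ (-k))ⁿ` inside the unit cube, those containing it, and all other cubes, on
  -- which the function is constant
  by_cases hm : m = 0
  · subst hm
    rcases le_or_gt 0 k with hk | hk
    · obtain ⟨j, rfl⟩ := Int.eq_ofNat_of_zero_le hk
      rw [setLIntegral_extremal_sq_sub hn hq hq1, cellMean_extremal hn hq hq1 hγ, sub_self,
        ← ofReal_measureReal (volume_cell_ne_top _ _), volume_real_cell_natCast hq,
        ← ENNReal.ofReal_mul (sq_nonneg ε), hεγ]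
      exact le_of_eq (by congr 1; ring)
    · have hsub : cell (n := n) 0 0 ⊆ cell k 0 := cell_zero_antitone hk.le
      have hmean : cellMean (extremal n q γ) k 0 = 0 := by
        rw [cellMean, setAverage_eq, setIntegral_eq_of_subset_of_forall_sdiff_eq_zero
          (measurableSet_cell _ _) hsub fun x hx => hsupp x hx.2]
        have := setIntegral_extremal (n := n) hn hq hq1 hγ 0
        simp only [Nat.cast_zero, zero_mul, mul_zero] at this
        rw [this, smul_zero]
      rw [hmean]
      have hind : (fun x => ENNReal.ofReal ((extremal n q γ x - 0) ^ 2)) =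
          (cell 0 0).indicator fun x => ENNReal.ofReal ((extremal n q γ x - 0) ^ 2) := by
        funext x
        by_cases hc : x ∈ cell 0 0
        · rw [Set.indicator_of_mem hc]
        · rw [Set.indicator_of_notMem hc, hsupp x hc]
          simp
      have h0 := setLIntegral_extremal_sq_sub (n := n) (γ := γ) hn hq hq1 0 0
      calc ∫⁻ x in cell k 0, ENNReal.ofReal ((extremal n q γ x - 0) ^ 2)
          ≤ ∫⁻ x, ENNReal.ofReal ((extremal n q γ x - 0) ^ 2) := setLIntegral_le_lintegral _ _
        _ = ∫⁻ x in cell 0 0, ENNReal.ofReal ((extremal n q γ x - 0) ^ 2) := by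
            rw [hind, lintegral_indicator (measurableSet_cell _ _), ← hind]
        _ = ENNReal.ofReal (ε ^ 2) * volume (cell (n := n) 0 0) := by
            simp only [Nat.cast_zero] at h0
            rw [h0, volume_cell, ← hεγ]
            simp
        _ ≤ _ := by gcongr
  · obtain ⟨x₀, hx₀⟩ := nonempty_of_measure_ne_zero (volume_cell_ne_zero k m)
    have hc : ∀ x ∈ cell k m, extremal n q γ x = extremal n q γ x₀ := fun x hx =>
      extremal_eq_of_mem_cell hm hx hx₀
    have hmean : cellMean (extremal n q γ) k m = extremal n q γ x₀ := by
      rw [cellMean, setAverage_eq, setIntegral_congr_fun (measurableSet_cell _ _) hc,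
        ← setAverage_eq, setAverage_const (volume_cell_ne_zero k m) (volume_cell_ne_top k m)]
    rw [hmean, setLIntegral_congr_fun (measurableSet_cell k m) (g := fun _ => 0)
      (fun x hx => by simp [hc x hx])]
    simp

/-- The extremal function, tested on the unit cube, bounds every admissible constant from below. -/
lemma JohnNirenberg.le_const {n : ℕ} (hn : 1 ≤ n) {q ε C : ℝ} (hq : q ^ 2 = 2 ^ n) (hq1 : 1 < q)
    (hε : 0 ≤ ε) (hden : 0 < q ^ 2 * Real.exp (ε / q) - Real.exp (q * ε)) (hC : 0 < C)
    (h : JohnNirenberg n ε C) :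
    (q ^ 2 - 1) / (q ^ 2 * Real.exp (ε / q) - Real.exp (q * ε)) ≤ C := by
  have hq0 : 0 < q := one_pos.trans hq1
  have hγ : 0 ≤ ε / q := by positivity
  have hqε : q * ε = q ^ 2 * (ε / q) := by field_simp
  have key := h _ (extremal_mem_bmoBall hn hq hq1 hε) _ ⟨0, 0, rfl⟩
  have hlt : Real.exp ((q ^ 2 - 1) * (ε / q)) < q ^ 2 := by
    have e : Real.exp (q * ε) = Real.exp ((q ^ 2 - 1) * (ε / q)) * Real.exp (ε / q) := by
      rw [← Real.exp_add, hqε]; ring_nf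
    rw [e, ← sub_mul] at hden
    linarith [(mul_pos_iff_of_pos_right (Real.exp_pos _)).1 hden]
  have hmean := cellMean_extremal (n := n) hn hq hq1 hγ 0
  simp only [Nat.cast_zero, zero_mul] at hmean
  have hvol : volume (cell (n := n) 0 0) = 1 := by simp [volume_cell]
  rw [setLAverage_congr (dyadicCube_ae_eq_cell _ _), setAverage_congr (dyadicCube_ae_eq_cell _ _),
    setLAverage_eq, setLIntegral_exp_extremal hn hq hq1 hlt, hvol, div_one] at key
  change _ ≤ ENNReal.ofReal (C * Real.exp (cellMean _ 0 0)) at key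
  rw [hmean, Real.exp_zero, mul_one, ENNReal.ofReal_le_ofReal_iff hC.le, ← hqε] at key
  exact key

/-! ### The sharp threshold and constant -/

/-- A form of the denominator of the sharp constant that displays its sign. -/
lemma denominator_eq {q : ℝ} (hq : 1 < q) (ε : ℝ) :
    q ^ 2 * Real.exp (ε / q) - Real.exp (q * ε) =
      Real.exp (ε / q) * (Real.exp (Real.log (q ^ 2)) - Real.exp ((q ^ 2 - 1) / q * ε)) := by
  have hq0 : 0 < q := one_pos.trans hq
  rw [Real.exp_log (by positivity), mul_sub, ← Real.exp_add]
  have : ε / q + (q ^ 2 - 1) / q * ε = q * ε := by field_simp; ring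
  rw [this]
  ring

lemma denominator_pos {q ε : ℝ} (hq : 1 < q) (hε : ε < q / (q ^ 2 - 1) * Real.log (q ^ 2)) :
    0 < q ^ 2 * Real.exp (ε / q) - Real.exp (q * ε) := by
  have hq0 : 0 < q := one_pos.trans hq
  have hq2 : 0 < q ^ 2 - 1 := by nlinarith
  rw [denominator_eq hq]
  refine mul_pos (Real.exp_pos _) (sub_pos.2 (Real.exp_lt_exp.2 ?_))
  rw [div_mul_eq_mul_div, lt_div_iff₀ hq2] at hε
  rw [div_mul_eq_mul_div, div_lt_iff₀ hq0]
  linarith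

lemma denominator_threshold {q : ℝ} (hq : 1 < q) :
    q ^ 2 * Real.exp (q / (q ^ 2 - 1) * Real.log (q ^ 2) / q) -
      Real.exp (q * (q / (q ^ 2 - 1) * Real.log (q ^ 2))) = 0 := by
  have hq0 : 0 < q := one_pos.trans hq
  have hq2 : 0 < q ^ 2 - 1 := by nlinarith
  rw [denominator_eq hq]
  have : (q ^ 2 - 1) / q * (q / (q ^ 2 - 1) * Real.log (q ^ 2)) = Real.log (q ^ 2) := by
    field_simp
  rw [this, sub_self, mul_zero]

lemma bmoBall_mono {n : ℕ} {ε ε' : ℝ} (h : ε ≤ ε') : bmoBall n ε ⊆ bmoBall n ε' :=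
  fun _ hφ => ⟨hφ.1, hφ.2.trans (ENNReal.ofReal_le_ofReal h)⟩

lemma isLeast_admissibleConstants {n : ℕ} (hn : 1 ≤ n) {q ε : ℝ} (hq : q ^ 2 = 2 ^ n) (hq1 : 1 < q)
    (hε : 0 ≤ ε) (hεlt : ε < q / (q ^ 2 - 1) * Real.log (q ^ 2)) :
    IsLeast (admissibleConstants n ε)
      ((q ^ 2 - 1) / (q ^ 2 * Real.exp (ε / q) - Real.exp (q * ε))) := by
  have hden := denominator_pos hq1 hεlt
  refine ⟨⟨div_pos (by nlinarith) hden, ?_⟩, fun C hC => hC.2.le_const hn hq hq1 hε hden hC.1⟩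
  obtain ⟨σ, δ, h⟩ := exists_isBellmanPair hq1 hε hden
  have hδ := profile_pos h.delta_lt_one
  have : profile σ / profile δ =
      (q ^ 2 - 1) / (q ^ 2 * Real.exp (ε / q) - Real.exp (q * ε)) := by
    rw [div_eq_div_iff hδ.ne' hden.ne', h.profile_eq]
  rw [← this]
  exact h.johnNirenberg hq

lemma isGreatest_admissibleThresholds {n : ℕ} (hn : 1 ≤ n) {q : ℝ} (hq : q ^ 2 = 2 ^ n)
    (hq1 : 1 < q) :
    IsGreatest (admissibleThresholds n) (q / (q ^ 2 - 1) * Real.log (q ^ 2)) := by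
  have hq0 : 0 < q := one_pos.trans hq1
  have hq2 : 0 < q ^ 2 - 1 := by nlinarith
  have hpos : 0 < q / (q ^ 2 - 1) * Real.log (q ^ 2) :=
    mul_pos (div_pos hq0 hq2) (Real.log_pos (by linarith))
  refine ⟨⟨hpos, fun ε hε hlt => ⟨_, (isLeast_admissibleConstants hn hq hq1 hε hlt).1⟩⟩, ?_⟩
  rintro ε₁ ⟨-, hε₁⟩
  by_contra! hlt
  obtain ⟨C, hC, hJN⟩ := hε₁ _ hpos.le hlt
  have hcont : Continuous fun ε : ℝ => C * (q ^ 2 * Real.exp (ε / q) - Real.exp (q * ε)) := by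
    fun_prop
  have hge : q ^ 2 - 1 ≤ C * (q ^ 2 * Real.exp (q / (q ^ 2 - 1) * Real.log (q ^ 2) / q) -
      Real.exp (q * (q / (q ^ 2 - 1) * Real.log (q ^ 2)))) := by
    refine ge_of_tendsto ((hcont.tendsto _).mono_left nhdsWithin_le_nhds)
      (Filter.eventually_of_mem (Ioo_mem_nhdsLT hpos) fun ε hε => ?_)
    have hden := denominator_pos hq1 hε.2
    have := JohnNirenberg.le_const hn hq hq1 hε.1.le hden hC
      fun φ hφ => hJN φ (bmoBall_mono hε.2.le hφ)
    exact (div_le_iff₀ hden).1 this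
  rw [denominator_threshold hq1, mul_zero] at hge
  linarith

end DyadicBMO

theorem theorem1p4 (n : ℕ) (hn : 1 ≤ n) :
    IsGreatest (DyadicBMO.admissibleThresholds n)
      ((2 : ℝ) ^ ((n : ℝ) / 2) / ((2 : ℝ) ^ n - 1) * (n : ℝ) * Real.log 2) ∧
    ∀ ε : ℝ, 0 ≤ ε →
      ε < (2 : ℝ) ^ ((n : ℝ) / 2) / ((2 : ℝ) ^ n - 1) * (n : ℝ) * Real.log 2 →
      IsLeast (DyadicBMO.admissibleConstants n ε)
        (((2 : ℝ) ^ n - 1) /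
          ((2 : ℝ) ^ n * Real.exp ((2 : ℝ) ^ (-((n : ℝ) / 2)) * ε)
            - Real.exp ((2 : ℝ) ^ ((n : ℝ) / 2) * ε))) := by
  have hq : ((2 : ℝ) ^ ((n : ℝ) / 2)) ^ 2 = 2 ^ n := by
    rw [← Real.rpow_mul_natCast zero_le_two]
    simp
  have hn0 : (0 : ℝ) < n := by exact_mod_cast hn
  have hq1 : 1 < (2 : ℝ) ^ ((n : ℝ) / 2) := Real.one_lt_rpow one_lt_two (by positivity)
  rw [Real.rpow_neg zero_le_two]
  set q := (2 : ℝ) ^ ((n : ℝ) / 2)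
  have hlog : q / ((2 : ℝ) ^ n - 1) * (n : ℝ) * Real.log 2 =
      q / (q ^ 2 - 1) * Real.log (q ^ 2) := by
    rw [hq, Real.log_pow, mul_assoc]
  rw [hlog, ← hq]
  refine ⟨DyadicBMO.isGreatest_admissibleThresholds hn hq hq1, fun ε hε hlt => ?_⟩
  rw [inv_mul_eq_div]
  exact DyadicBMO.isLeast_admissibleConstants hn hq hq1 hε hlt
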